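/- Let $\theta\in\mathbb R^p$ and $\phi\in\mathbb R^q$ be jointly Gaussian random vectors, and let $u\in\mathbb R^s$, $v\in\mathbb R^t$ be centered Gaussian vectors, independent of each other and jointly independent of $(\theta,\phi)$, where $1\le t\le q$. Write $Q_{zw}$ for the cross-covariance matrix of $z$ and $w$, and assume that $Q_{\theta\theta}$ and $Q_{uu}$ are positive definite. For a fixed matrix $F\in\mathbb R^{s\times p}$ and a variable matrix $G\in\mathbb R^{t\times q}$ put $x=F\theta+u$, $y=G\phi+v$, and let $$D(G)=I(\theta;x,y)-I(\theta;x)$$ be the information gain, where $I$ denotes mutual information. Put $M=Q_{\phi\theta}Q_{\theta\theta}^{-1}$, $Q_{\phi\phi|\theta}=Q_{\phi\phi}-Q_{\phi\theta}Q_{\theta\theta}^{-1}Q_{\theta\phi}$ and $Q_{\theta\theta|x}=(Q_{\theta\theta}^{-1}+F^TQ_{uu}^{-1}F)^{-1}$. Assume that $Q_{\phi\phi|\theta}=\sigma^2 I_q$ with $\sigma^2>0$, and let $$Q_{vv}=U_v\,\mathrm{Diag}(\sigma_{v,1}^2,\dots,\sigma_{v,t}^2)\,U_v^T,\qquad MQ_{\theta\theta|x}M^T=U_\xi\,\Sigma_\xi\,U_\xi^T,\quad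 \Sigma_\xi=\mathrm{Diag}(\sigma_{\xi,1}^2,\dots,\sigma_{\xi,q}^2),$$ be eigendecompositions with orthogonal $U_v,U_\xi$, where the eigenvalues of $Q_{vv}$ are distinct and positive, $0<\sigma_{v,1}^2<\dots<\sigma_{v,t}^2$, and $\sigma_{\xi,1}^2\ge\dots\ge\sigma_{\xi,q}^2\ge0$ are such that the nonzero ones are distinct and there is at least one of them. Let $P>0$. For $\mu>0$ and $1\le i\le t$ put $$w_i(\mu)=\frac{\sigma_{v,i}^2}{2\sigma^2(\sigma^2+\sigma_{\xi,i}^2)}\left(-(2\sigma^2+\sigma_{\xi,i}^2)+\sqrt{\sigma_{\xi,i}^4+\frac{4\sigma^2(\sigma^2+\sigma_{\xi,i}^2)\,\sigma_{\xi,i}^2}{2\mu\,\sigma_{v,i}^2}}\right),$$ and let $\kappa(\mu)$, if it exists, be the largest integer $k$ with $1\le k\le\min(t,\operatorname{rank}\Sigma_\xi)$ such that $w_i(\mu)>0$ for all $i\le k$. Then there is exactly one $\mu>0$ for which $\kappa=\kappa(\mu)$ exists and $\sum_{i=1}^{\kappa}w_i(\mu)=P$. With this $\mu$ and $\kappa$,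 a matrix $G^*\in\mathbb R^{t\times q}$ maximizes $D(G)$ subject to $\operatorname{tr}(GG^T)\le P$ if and only if $$G^*=U_v\Lambda^*U_\xi^T$$ for a diagonal matrix $\Lambda^*\in\mathbb R^{t\times q}$ whose diagonal entries satisfy $\lambda_{ii}^{*2}=w_i(\mu)$ for $i\le\kappa$ and $\lambda_{ii}^{*2}=0$ for $\kappa<i\le t$. In particular, a maximizer exists and is unique up to the signs of $\lambda_{11}^*,\dots,\lambda_{\kappa\kappa}^*$. -/

import Mathlib

open MeasureTheory ProbabilityTheory Matrix

noncomputable section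

namespace TwoChannel

/-- The cross-covariance matrix `Q_{XY}` of two real random vectors; `crossCov Pr X X` is the
covariance matrix of `X`. -/
def crossCov {Ω : Type*} [MeasurableSpace Ω] (Pr : Measure Ω) {m n : ℕ}
    (X : Ω → Fin m → ℝ) (Y : Ω → Fin n → ℝ) : Matrix (Fin m) (Fin n) ℝ :=
  Matrix.of fun i j => cov[fun ω => X ω i, fun ω => Y ω j; Pr]

/-- The mutual information `I(X;Y)` in nats: the Kullback-Leibler divergence of the joint law
from the product of the two marginal laws. -/
def mutualInfo {Ω A B : Type*} [MeasurableSpace Ω] [MeasurableSpace A] [MeasurableSpace B]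
    (Pr : Measure Ω) (X : Ω → A) (Y : Ω → B) : ENNReal :=
  InformationTheory.klDiv (Pr.map fun ω => (X ω, Y ω)) ((Pr.map X).prod (Pr.map Y))

/-- The output `A z + n` of a linear channel with channel matrix `A`, input `z` and noise `n`. -/
def channel {Ω : Type*} {m n : ℕ} (A : Matrix (Fin m) (Fin n) ℝ) (z : Ω → Fin n → ℝ)
    (noise : Ω → Fin m → ℝ) : Ω → Fin m → ℝ :=
  fun ω => A *ᵥ z ω + noise ω

/-- The assumptions on the two signals and the two noises: the signals `θ, φ` are jointly
Gaussian, the noises `u, v` are centered Gaussian, independent of each other and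
(jointly) independent of the pair of signals. -/
structure IsGaussianModel {Ω : Type*} [MeasurableSpace Ω] (Pr : Measure Ω) {p q s t : ℕ}
    (θ : Ω → Fin p → ℝ) (φ : Ω → Fin q → ℝ) (u : Ω → Fin s → ℝ) (v : Ω → Fin t → ℝ) : Prop where
  signals : HasGaussianLaw (fun ω => (θ ω, φ ω)) Pr
  noise_u : HasGaussianLaw u Pr
  noise_v : HasGaussianLaw v Pr
  mean_u : ∫ ω, u ω ∂Pr = 0
  mean_v : ∫ ω, v ω ∂Pr = 0
  indep_noises : IndepFun u v Pr
  indep_signals : IndepFun (fun ω => (u ω, v ω)) (fun ω => (θ ω, φ ω)) Pr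

/-- The information gain `D(G) = I(θ; x, y) - I(θ; x)` of the secondary channel matrix `G`, where
`x = F θ + u` and `y = G φ + v`. -/
def infoGain {Ω : Type*} [MeasurableSpace Ω] (Pr : Measure Ω) {p q s t : ℕ}
    (θ : Ω → Fin p → ℝ) (φ : Ω → Fin q → ℝ) (u : Ω → Fin s → ℝ) (v : Ω → Fin t → ℝ)
    (F : Matrix (Fin s) (Fin p) ℝ) (G : Matrix (Fin t) (Fin q) ℝ) : ℝ :=
  (mutualInfo Pr θ fun ω => (channel F θ u ω, channel G φ v ω)).toReal
    - (mutualInfo Pr θ (channel F θ u)).toReal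

/-- `G` solves the design problem: it maximizes the information gain among all matrices of the
given size with `tr (G Gᵀ) ≤ P`. -/
def IsOptimal {Ω : Type*} [MeasurableSpace Ω] (Pr : Measure Ω) {p q s t : ℕ}
    (θ : Ω → Fin p → ℝ) (φ : Ω → Fin q → ℝ) (u : Ω → Fin s → ℝ) (v : Ω → Fin t → ℝ)
    (F : Matrix (Fin s) (Fin p) ℝ) (P : ℝ) (G : Matrix (Fin t) (Fin q) ℝ) : Prop :=
  (G * Gᵀ).trace ≤ P ∧
    ∀ H : Matrix (Fin t) (Fin q) ℝ, (H * Hᵀ).trace ≤ P →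
      infoGain Pr θ φ u v F H ≤ infoGain Pr θ φ u v F G

/-- The matrix `M = Q_{φθ} Q_{θθ}⁻¹` of the minimum mean squared error estimator of `φ`
from `θ`. -/
def estMatrix {Ω : Type*} [MeasurableSpace Ω] (Pr : Measure Ω) {p q : ℕ}
    (θ : Ω → Fin p → ℝ) (φ : Ω → Fin q → ℝ) : Matrix (Fin q) (Fin p) ℝ :=
  crossCov Pr φ θ * (crossCov Pr θ θ)⁻¹

/-- The conditional covariance `Q_{φφ|θ} = Q_{φφ} - Q_{φθ} Q_{θθ}⁻¹ Q_{θφ}` of `φ` given `θ`, for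
jointly Gaussian `φ, θ`. -/
def condCov {Ω : Type*} [MeasurableSpace Ω] (Pr : Measure Ω) {p q : ℕ}
    (φ : Ω → Fin q → ℝ) (θ : Ω → Fin p → ℝ) : Matrix (Fin q) (Fin q) ℝ :=
  crossCov Pr φ φ - crossCov Pr φ θ * (crossCov Pr θ θ)⁻¹ * crossCov Pr θ φ

/-- The conditional covariance `Q_{θθ|x} = (Q_{θθ}⁻¹ + Fᵀ Q_{uu}⁻¹ F)⁻¹` of the signal `θ` given
the output `x = F θ + u` of the primary channel. -/
def postCov {Ω : Type*} [MeasurableSpace Ω] (Pr : Measure Ω) {p s : ℕ}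
    (θ : Ω → Fin p → ℝ) (u : Ω → Fin s → ℝ) (F : Matrix (Fin s) (Fin p) ℝ) :
    Matrix (Fin p) (Fin p) ℝ :=
  ((crossCov Pr θ θ)⁻¹ + Fᵀ * (crossCov Pr u u)⁻¹ * F)⁻¹

/-- The rectangular `t × q` diagonal matrix with diagonal entries `d`. -/
def rectDiag {t : ℕ} (q : ℕ) (d : Fin t → ℝ) : Matrix (Fin t) (Fin q) ℝ :=
  Matrix.of fun i j => if (i : ℕ) = (j : ℕ) then d i else 0

/-- The power of an active subchannel in the mercury/waterfilling policy with multiplier `μ`,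
noise variance `b`, signal variance `a` and conditional variance `c` of the components of `φ`
given `θ`. For `c = 1` it equals
`b / (2 (1 + a)) * (-(2 + a) + √(a² + 4 (1 + a) a / (2 μ b)))`. -/
def waterLevel (c b a μ : ℝ) : ℝ :=
  b / (2 * c * (c + a)) *
    (-(2 * c + a) + Real.sqrt (a ^ 2 + 4 * c * (c + a) * a / (2 * μ * b)))

/-- `κ` is the largest integer between `1` and `r` (and at most the number `t` of subchannels) such
that the first `κ` of the numbers `w i` are positive. -/
def IsActiveCount {t : ℕ} (w : Fin t → ℝ) (r κ : ℕ) : Prop :=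
  IsGreatest {k : ℕ | 1 ≤ k ∧ k ≤ r ∧ k ≤ t ∧ ∀ i : Fin t, (i : ℕ) < k → 0 < w i} κ

end TwoChannel

end

/-!
Write `b` for the eigenvalues of `Q_vv`, `a` for those of `M Q_{θθ|x} Mᵀ` and `c = σ²`.

**Reduction to a determinant problem.** Split `φ = M θ + r` with `r` uncorrelated with `θ`, hence
independent of it by joint Gaussianity. Then both `x` and `(x, y)` are outputs of a channel
`z = A θ + n` whose Gaussian noise `n` is independent of `θ`. The law of `(θ, z)` has the density
`f (z - A θ) / g z` with respect to the product of its marginals, where `f` and `g` are the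
densities of `n` and `z`, so the mutual information is half the difference of the log-determinants
of the covariances of `z` and `n` (`toReal_mutualInfo_channel`). The Schur complement and the
Woodbury identity turn the difference of two of these values into a difference of log-determinants
of `t × t` matrices (`IsGaussianModel.infoGain_eq`). In the eigenbases, with `Uvᵀ G Uξ` in place of
`G`, it becomes half of
`log det (diag b + G diag (c + a) Gᵀ) - log det (diag b + c G Gᵀ)`, which is `logDetGain`.

**The maximizers are diagonal.** Let `X` and `Y` be the two matrices above. A maximizer exists by
compactness and satisfies `(X⁻¹ G diag (c + a)) - (Y⁻¹ G diag c) = ν G` with `ν > 0`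
(`IsMaximizer.exists_multiplier`). Multiplied by `Gᵀ` from the right this reads
`(Y⁻¹ - X⁻¹) diag b = ν G Gᵀ`. The right side is symmetric, so `Y⁻¹ - X⁻¹` commutes with `diag b`,
and since the `b i` are distinct it is diagonal. Hence `G Gᵀ`, `Y` and `X` are diagonal as well, and
the first-order condition, read entry by entry, says that the nonzero entries in one row of `G` sit
at columns with the same value of `a`. This value is not zero, since otherwise `X` and `Y` would
agree in that row and `ν` would vanish. The nonzero values of `a` being distinct, every row has at
most one nonzero entry, and the orthogonality of the rows makes `G` monomial (`exists_eq_mono`).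
It remains to see which column each row uses. No idle column has a larger `a` than one in use, for
one could move a row there. Exchanging the columns of two rows, once with the
signal-to-noise ratios carried along and once with the powers kept, shows that rows with smaller
`b` have the larger ratios, and rows with larger ratios the larger `a`. This forces every row in use
onto its own diagonal position (`IsMaximizer.exists_eq_rectDiag`).

**The powers.** For diagonal `G` the gain is a sum over the subchannels, and on each of them it lies
below the line of slope `ν` through its value at the water level, with equality at that point
only (`pairGain_sub_le`). So the powers of a maximizer are the water levels (`isMaximizer_iff`) of
any multiplier whose water levels exhaust `P`. There is exactly one, because the total of the
positive parts of the water levels is continuous in `μ`, strictly decreasing while positive, at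
least `P` for small `μ` and zero for large `μ` (`existsUnique_totalPower_eq`). The condition
`waterLevel > 0` means `2 μ b < a`, which holds on an initial segment of the indices, and this is
what makes `κ` count the active subchannels (`IsActiveCount.lt_iff`).
-/

noncomputable section

namespace TwoChannel

/-! ### The gain as a function of the matrix, and its first-order conditions -/

section FirstOrder

variable {n m : Type*} [Fintype n] [Fintype m]

theorem trace_mul_transpose_self_eq (G : Matrix n m ℝ) :
    (G * Gᵀ).trace = ∑ i, ∑ j, G i j ^ 2 := by
  simp [trace, mul_apply, pow_two]

theorem trace_mul_transpose_self_nonneg (G : Matrix n m ℝ) : 0 ≤ (G * Gᵀ).trace := by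
  rw [trace_mul_transpose_self_eq]
  positivity

theorem eq_zero_of_trace_mul_transpose_self_nonpos {G : Matrix n m ℝ}
    (h : (G * Gᵀ).trace ≤ 0) : G = 0 :=
  trace_mul_conjTranspose_self_eq_zero_iff.1 (by
    simpa using le_antisymm h (trace_mul_transpose_self_nonneg G))

variable [DecidableEq n] [DecidableEq m]

/-- The covariance `diag b + G diag e Gᵀ` of the output of the channel `G` with independent input
components of variances `e` and independent noise components of variances `b`. -/
def outCov (b : n → ℝ) (e : m → ℝ) (G : Matrix n m ℝ) : Matrix n n ℝ :=
  diagonal b + G * diagonal e * Gᵀ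

/-- Twice the information gain of `G` in the eigenbases: `b` are the noise variances, `a` the
variances of the informative part of the input and `c` the variance of the rest. -/
def logDetGain (b : n → ℝ) (a : m → ℝ) (c : ℝ) (G : Matrix n m ℝ) : ℝ :=
  Real.log (outCov b (fun j => c + a j) G).det - Real.log (outCov b (fun _ => c) G).det

/-- `G` maximizes `logDetGain b a c` among the matrices with `tr (G Gᵀ) ≤ P`. -/
def IsMaximizer (b : n → ℝ) (a : m → ℝ) (c P : ℝ) (G : Matrix n m ℝ) : Prop :=
  (G * Gᵀ).trace ≤ P ∧
    ∀ H : Matrix n m ℝ, (H * Hᵀ).trace ≤ P → logDetGain b a c H ≤ logDetGain b a c G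

/-- Half the gradient of `G ↦ log det (outCov b e G)` for the trace inner product. -/
def logDetGrad (b : n → ℝ) (e : m → ℝ) (G : Matrix n m ℝ) : Matrix n m ℝ :=
  (outCov b e G)⁻¹ * G * diagonal e

/-- Half the gradient of `logDetGain b a c` for the trace inner product. -/
def gainGrad (b : n → ℝ) (a : m → ℝ) (c : ℝ) (G : Matrix n m ℝ) : Matrix n m ℝ :=
  logDetGrad b (fun j => c + a j) G - logDetGrad b (fun _ => c) G

theorem outCov_posDef {b : n → ℝ} {e : m → ℝ} (hb : ∀ i, 0 < b i) (he : ∀ j, 0 ≤ e j)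
    (G : Matrix n m ℝ) : (outCov b e G).PosDef := by
  unfold outCov
  refine (PosDef.diagonal hb).add_posSemidef ?_
  have := (PosSemidef.diagonal (n := m) (d := e) he).mul_mul_conjTranspose_same G
  simpa using this

theorem differentiable_det : Differentiable ℝ fun M : n → n → ℝ => (Matrix.of M).det := by
  simp only [Matrix.det_apply, Matrix.of_apply]
  fun_prop

/-- Jacobi's formula for the derivative of the determinant along a curve through the identity. -/
theorem hasDerivAt_det_one {γ : ℝ → n → n → ℝ} {γ' : n → n → ℝ} (hγ : HasDerivAt γ γ' 0)
    (h0 : γ 0 = (1 : Matrix n n ℝ)) :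
    HasDerivAt (fun ε => (Matrix.of (γ ε)).det) (Matrix.of γ').trace 0 := by
  have hF := (differentiable_det (n := n) (γ 0)).hasFDerivAt
  have h1 := hF.comp_hasDerivAt (0 : ℝ) hγ
  convert! h1 using 1
  -- the directional derivative of `det` at `1` is read off from the affine path `1 + r • γ'`
  have hline : HasDerivAt (fun r : ℝ => γ 0 + r • γ') γ' 0 := by
    simpa using ((hasDerivAt_id (0 : ℝ)).smul_const γ').const_add (γ 0)
  have h2 : HasDerivAt (fun r : ℝ => (Matrix.of (γ 0 + r • γ')).det)
      (fderiv ℝ (fun M : n → n → ℝ => (Matrix.of M).det) (γ 0) γ') 0 := by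
    have h3 : HasFDerivAt (fun M : n → n → ℝ => (Matrix.of M).det)
      (fderiv ℝ (fun M : n → n → ℝ => (Matrix.of M).det) (γ 0)) (γ 0 + (0 : ℝ) • γ') := by
      simpa using hF
    exact h3.comp_hasDerivAt (0 : ℝ) hline
  have h4 : (fun r : ℝ => (Matrix.of (γ 0 + r • γ')).det) = fun r =>
      1 + (Matrix.of γ').trace * r + ((1 + (Polynomial.X : Polynomial ℝ) •
        (Matrix.of γ').map Polynomial.C).det).divX.divX.eval r * r ^ 2 := by
    funext r
    rw [← Matrix.det_one_add_smul, h0]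
    rfl
  rw [h4] at h2
  set q := ((1 + (Polynomial.X : Polynomial ℝ) • (Matrix.of γ').map Polynomial.C).det).divX.divX
  have h5 : HasDerivAt (fun r : ℝ => 1 + (Matrix.of γ').trace * r + q.eval r * r ^ 2)
      (Matrix.of γ').trace 0 := by
    have := (((hasDerivAt_id (0 : ℝ)).const_mul (Matrix.of γ').trace).const_add 1).add
      ((q.hasDerivAt 0).mul ((hasDerivAt_id (0 : ℝ)).pow 2))
    convert! this using 1
    simp
  exact h5.unique h2

/-- Writing `X = outCov b e G`, the curve `outCov b e (G + ε E)` is `X` times a curve through the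
identity, so that the derivative of the determinant at the identity is all that is needed. -/
theorem hasDerivAt_log_det_outCov {b : n → ℝ} {e : m → ℝ} (hb : ∀ i, 0 < b i)
    (he : ∀ j, 0 ≤ e j) (G E : Matrix n m ℝ) :
    HasDerivAt (fun ε : ℝ => Real.log (outCov b e (G + ε • E)).det)
      (2 * (logDetGrad b e G * Eᵀ).trace) 0 := by
  set X := outCov b e G with hX
  have hpd : X.PosDef := outCov_posDef hb he G
  have hu : IsUnit X.det := hpd.det_pos.ne'.isUnit
  set Z₁ := G * diagonal e * Eᵀ + E * diagonal e * Gᵀ with hZ₁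
  set Z₂ := E * diagonal e * Eᵀ with hZ₂
  have hexp (ε : ℝ) : outCov b e (G + ε • E) = X * (1 + ε • (X⁻¹ * Z₁) + ε ^ 2 • (X⁻¹ * Z₂)) := by
    rw [mul_add, mul_add, mul_smul_comm, mul_smul_comm, ← mul_assoc, ← mul_assoc,
      mul_nonsing_inv _ hu, mul_one, one_mul, one_mul, hX, hZ₁, hZ₂]
    unfold outCov
    simp only [transpose_add, transpose_smul, smul_add, pow_two]
    simp only [Matrix.add_mul, Matrix.mul_add, Matrix.smul_mul, Matrix.mul_smul, smul_add,
      smul_smul]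
    abel
  have hγ : HasDerivAt (fun (ε : ℝ) (i j : n) =>
      (1 : Matrix n n ℝ) i j + ε * (X⁻¹ * Z₁) i j + ε ^ 2 * (X⁻¹ * Z₂) i j)
      (fun i j => (X⁻¹ * Z₁) i j) 0 := by
    refine hasDerivAt_pi.2 fun i => hasDerivAt_pi.2 fun j => ?_
    have h1 := (((hasDerivAt_id (0 : ℝ)).mul_const ((X⁻¹ * Z₁) i j)).const_add
      ((1 : Matrix n n ℝ) i j)).add
      (((hasDerivAt_id (0 : ℝ)).pow 2).mul_const ((X⁻¹ * Z₂) i j))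
    convert! h1 using 1
    simp
  have hdet := hasDerivAt_det_one hγ (by ext i j; simp)
  have hval : (outCov b e (G + (0 : ℝ) • E)).det = X.det := by simp [hX]
  have h2 : HasDerivAt (fun ε : ℝ => (outCov b e (G + ε • E)).det)
      (X.det * (X⁻¹ * Z₁).trace) 0 := by
    have := hdet.const_mul X.det
    refine this.congr_of_eventuallyEq (Filter.Eventually.of_forall fun ε => ?_)
    simp only [hexp ε, det_mul]
    rfl
  have h3 := h2.log (by rw [hval]; exact hpd.det_pos.ne')
  rw [hval, mul_div_cancel_left₀ _ hpd.det_pos.ne'] at h3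
  convert h3 using 1
  rw [logDetGrad, ← hX]
  have hsymm : (X⁻¹)ᵀ = X⁻¹ := by
    have := hpd.inv.isHermitian
    simpa [IsHermitian] using this
  have htr : (X⁻¹ * (E * diagonal e * Gᵀ)).trace = (X⁻¹ * G * diagonal e * Eᵀ).trace := by
    rw [← trace_transpose]
    simp only [transpose_mul, transpose_transpose, diagonal_transpose, hsymm]
    rw [trace_mul_comm]
    simp only [Matrix.mul_assoc]
  rw [hZ₁, mul_add, trace_add, htr, two_mul]
  simp only [Matrix.mul_assoc]

theorem hasDerivAt_logDetGain {b : n → ℝ} {a : m → ℝ} {c : ℝ} (hb : ∀ i, 0 < b i)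
    (ha : ∀ j, 0 ≤ a j) (hc : 0 < c) (G E : Matrix n m ℝ) :
    HasDerivAt (fun ε : ℝ => logDetGain b a c (G + ε • E))
      (2 * (gainGrad b a c G * Eᵀ).trace) 0 := by
  have h := (hasDerivAt_log_det_outCov hb (fun j => add_nonneg hc.le (ha j)) G E).sub
    (hasDerivAt_log_det_outCov (e := fun _ => c) hb (fun _ => hc.le) G E)
  convert! h using 1
  rw [gainGrad, Matrix.sub_mul, trace_sub, mul_sub]

/-- At a maximizer the gain has no positive derivative in a feasible direction `E`. Feasible is
every direction if the power constraint is slack, and always one that decreases the power to first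
order. -/
theorem gainGrad_trace_nonpos {b : n → ℝ} {a : m → ℝ} {c P : ℝ} (hb : ∀ i, 0 < b i)
    (ha : ∀ j, 0 ≤ a j) (hc : 0 < c) {G : Matrix n m ℝ} (hG : IsMaximizer b a c P G)
    {E : Matrix n m ℝ} (hE : (G * Gᵀ).trace < P ∨ (G * Eᵀ).trace < 0) :
    (gainGrad b a c G * Eᵀ).trace ≤ 0 := by
  by_contra! hpos
  have hd := hasDerivAt_logDetGain hb ha hc G E
  have hgt : ∀ᶠ ε in nhdsWithin (0 : ℝ) (Set.Ioi 0),
      logDetGain b a c G < logDetGain b a c (G + ε • E) := by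
    have := (hasDerivWithinAt_iff_tendsto_slope' (by simp)).1
      (hd.hasDerivWithinAt (s := Set.Ioi 0))
    filter_upwards [this.eventually (lt_mem_nhds (show (0 : ℝ) < _ by positivity)),
      self_mem_nhdsWithin] with ε h1 h2
    rw [slope_def_field] at h1
    have h3 : (0 : ℝ) < ε := h2
    simp only [sub_zero, zero_smul, add_zero] at h1
    have := (div_pos_iff_of_pos_right h3).1 h1
    linarith
  have hexp (ε : ℝ) : ((G + ε • E) * (G + ε • E)ᵀ).trace
      = (G * Gᵀ).trace + ε * (2 * (G * Eᵀ).trace + ε * (E * Eᵀ).trace) := by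
    have : (E * Gᵀ).trace = (G * Eᵀ).trace := by
      rw [← trace_transpose, transpose_mul, transpose_transpose]
    simp only [transpose_add, transpose_smul, Matrix.add_mul, Matrix.mul_add, Matrix.smul_mul,
      Matrix.mul_smul, trace_add, trace_smul, smul_eq_mul, this]
    ring
  have hfeas : ∀ᶠ ε in nhdsWithin (0 : ℝ) (Set.Ioi 0),
      ((G + ε • E) * (G + ε • E)ᵀ).trace ≤ P := by
    simp only [hexp]
    rcases hE with hE | hE
    · have hcont : Continuous fun ε : ℝ => (G * Gᵀ).trace +
          ε * (2 * (G * Eᵀ).trace + ε * (E * Eᵀ).trace) := by fun_prop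
      have : ∀ᶠ ε in nhds (0 : ℝ), (G * Gᵀ).trace +
          ε * (2 * (G * Eᵀ).trace + ε * (E * Eᵀ).trace) < P :=
        hcont.continuousAt.eventually (gt_mem_nhds (by simpa using hE))
      filter_upwards [nhdsWithin_le_nhds this] with ε h using h.le
    · have hcont : Continuous fun ε : ℝ => 2 * (G * Eᵀ).trace + ε * (E * Eᵀ).trace := by fun_prop
      have : ∀ᶠ ε in nhds (0 : ℝ), 2 * (G * Eᵀ).trace + ε * (E * Eᵀ).trace < 0 :=
        hcont.continuousAt.eventually (gt_mem_nhds (by simpa using by linarith))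
      filter_upwards [nhdsWithin_le_nhds this, self_mem_nhdsWithin] with ε h1 h2
      have h3 : (0 : ℝ) < ε := h2
      nlinarith [hG.1]
  obtain ⟨ε, h1, h2⟩ := (hgt.and hfeas).exists
  exact absurd (hG.2 _ h2) (not_le.2 h1)

theorem logDetGain_zero (b : n → ℝ) (a : m → ℝ) (c : ℝ) : logDetGain b a c 0 = 0 := by
  simp [logDetGain, outCov]

/-- The gradient times `Gᵀ` no longer involves `a` and `c` except through the two inverses, since
`G diag e Gᵀ = outCov b e G - diag b`. -/
theorem gainGrad_mul_transpose {b : n → ℝ} {a : m → ℝ} {c : ℝ} (hb : ∀ i, 0 < b i)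
    (ha : ∀ j, 0 ≤ a j) (hc : 0 < c) (G : Matrix n m ℝ) :
    gainGrad b a c G * Gᵀ = ((outCov b (fun _ => c) G)⁻¹ - (outCov b (fun j => c + a j) G)⁻¹)
      * diagonal b := by
  have key {e : m → ℝ} (he : ∀ j, 0 ≤ e j) :
      logDetGrad b e G * Gᵀ = 1 - (outCov b e G)⁻¹ * diagonal b := by
    have hu := (outCov_posDef hb he G).det_pos.ne'.isUnit
    have h1 : diagonal b = outCov b e G - G * diagonal e * Gᵀ := by simp [outCov]
    rw [h1, Matrix.mul_sub, nonsing_inv_mul _ hu, sub_sub_cancel, logDetGrad]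
    simp only [Matrix.mul_assoc]
  rw [gainGrad, Matrix.sub_mul, key (fun j => add_nonneg hc.le (ha j)),
    key (e := fun _ => c) (fun _ => hc.le), Matrix.sub_mul]
  abel

/-- The first-order conditions: a maximizer with positive gain uses the whole power, and the
gradient at `G` is a positive multiple of `G`. -/
theorem IsMaximizer.exists_multiplier {b : n → ℝ} {a : m → ℝ} {c P : ℝ} (hb : ∀ i, 0 < b i)
    (ha : ∀ j, 0 ≤ a j) (hc : 0 < c) {G : Matrix n m ℝ} (hG : IsMaximizer b a c P G)
    (hpos : 0 < logDetGain b a c G) :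
    ∃ ν : ℝ, 0 < ν ∧ gainGrad b a c G = ν • G ∧ (G * Gᵀ).trace = P := by
  set N := gainGrad b a c G with hN
  have hG0 : G ≠ 0 := by
    rintro rfl
    simp [logDetGain_zero] at hpos
  have hGG : 0 < (G * Gᵀ).trace := by
    by_contra! h
    exact hG0 (eq_zero_of_trace_mul_transpose_self_nonpos h)
  -- a vanishing gradient would make the two inverses, hence the two determinants, equal
  have hN0 : N ≠ 0 := by
    intro h0
    have h1 := gainGrad_mul_transpose hb ha hc G
    rw [← hN, h0, Matrix.zero_mul] at h1
    have hbu : IsUnit (diagonal b).det := by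
      simpa [det_diagonal, Finset.prod_ne_zero_iff] using fun i => (hb i).ne'
    have h2 : (outCov b (fun _ => c) G)⁻¹ - (outCov b (fun j => c + a j) G)⁻¹ = 0 := by
      have := congrArg (· * (diagonal b)⁻¹) h1
      simpa [Matrix.mul_assoc, mul_nonsing_inv _ hbu] using this.symm
    have h3 := congrArg det (sub_eq_zero.1 h2)
    rw [det_nonsing_inv, det_nonsing_inv, Ring.inverse_eq_inv', _root_.inv_inj] at h3
    simp [logDetGain, h3] at hpos
  have hsymm (A B : Matrix n m ℝ) : (A * Bᵀ).trace = (B * Aᵀ).trace := by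
    rw [← trace_transpose, transpose_mul, transpose_transpose]
  set α := (N * Gᵀ).trace / (G * Gᵀ).trace with hα
  have hαG : α * (G * Gᵀ).trace = (N * Gᵀ).trace := div_mul_cancel₀ _ hGG.ne'
  set R := N - α • G with hR
  have hGR : (G * Rᵀ).trace = 0 := by
    rw [hsymm, hR, Matrix.sub_mul, trace_sub, Matrix.smul_mul, trace_smul, smul_eq_mul, hαG,
      sub_self]
  have hNR : (N * Rᵀ).trace = (R * Rᵀ).trace := by
    have : N = R + α • G := by simp [hR]
    conv_lhs => rw [this]
    rw [Matrix.add_mul, trace_add, Matrix.smul_mul, trace_smul, hGR, smul_zero, add_zero]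
  -- the component of the gradient orthogonal to `G` vanishes
  have hR0 : R = 0 := by
    apply eq_zero_of_trace_mul_transpose_self_nonpos
    -- `R - ε • G` decreases the power to first order, and `ε → 0`
    have hε : ∀ ε : ℝ, 0 < ε → (R * Rᵀ).trace - ε * (N * Gᵀ).trace ≤ 0 := by
      intro ε hε
      have := gainGrad_trace_nonpos (E := R - ε • G) hb ha hc hG (Or.inr (by
        rw [transpose_sub, transpose_smul, Matrix.mul_sub, Matrix.mul_smul, trace_sub, trace_smul,
          hGR, smul_eq_mul]
        nlinarith))
      rwa [← hN, transpose_sub, transpose_smul, Matrix.mul_sub, Matrix.mul_smul, trace_sub,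
        trace_smul, hNR, smul_eq_mul] at this
    have hlim : Filter.Tendsto (fun ε : ℝ => (R * Rᵀ).trace - ε * (N * Gᵀ).trace)
        (nhdsWithin 0 (Set.Ioi 0)) (nhds ((R * Rᵀ).trace - 0 * (N * Gᵀ).trace)) :=
      (by fun_prop : Continuous fun ε : ℝ =>
        (R * Rᵀ).trace - ε * (N * Gᵀ).trace).continuousAt.tendsto.mono_left nhdsWithin_le_nhds
    rw [zero_mul, sub_zero] at hlim
    exact le_of_tendsto hlim (by filter_upwards [self_mem_nhdsWithin] with ε h using hε ε h)
  have hNα : N = α • G := sub_eq_zero.1 hR0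
  have hα0 : 0 ≤ α := by
    have := gainGrad_trace_nonpos (E := -G) hb ha hc hG (Or.inr (by
      rw [transpose_neg, Matrix.mul_neg, trace_neg]; linarith))
    rw [← hN, transpose_neg, Matrix.mul_neg, trace_neg] at this
    rw [hα]
    exact div_nonneg (by linarith) hGG.le
  refine ⟨α, lt_of_le_of_ne hα0 ?_, hNα, le_antisymm hG.1 ?_⟩
  · rintro h
    rw [← h, zero_smul] at hNα
    exact hN0 hNα
  · by_contra! hlt
    have := gainGrad_trace_nonpos (E := N) hb ha hc hG (Or.inl hlt)
    exact hN0 (eq_zero_of_trace_mul_transpose_self_nonpos this)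

end FirstOrder

/-! ### Monomial matrices -/

section Monomial

variable {n m : Type*} [Fintype n] [DecidableEq n] [Fintype m] [DecidableEq m]

/-- The matrix whose row `i` has the entry `g i` in column `σ i` and zeros elsewhere. For injective
`σ` every row and every column has at most one nonzero entry. -/
def mono (σ : n → m) (g : n → ℝ) : Matrix n m ℝ :=
  Matrix.of fun i j => if j = σ i then g i else 0

omit [Fintype n] in
theorem mono_mul_diagonal_mul_transpose {σ : n → m} (hσ : Function.Injective σ) (g : n → ℝ)
    (e : m → ℝ) : mono σ g * diagonal e * (mono σ g)ᵀ = diagonal fun i => e (σ i) * g i ^ 2 := by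
  ext i k
  rw [mul_apply, Finset.sum_eq_single (σ i)]
  · by_cases h : i = k
    · subst h
      simp [mono, mul_diagonal]
      ring
    · simp [mono, mul_diagonal, h, hσ.ne h]
  · intro j _ hj
    simp [mono, mul_diagonal, hj]
  · simp

omit [Fintype n] in
theorem outCov_mono {σ : n → m} (hσ : Function.Injective σ) (b g : n → ℝ) (e : m → ℝ) :
    outCov b e (mono σ g) = diagonal fun i => b i + e (σ i) * g i ^ 2 := by
  rw [outCov, mono_mul_diagonal_mul_transpose hσ, diagonal_add]

omit [Fintype n] in
theorem outCov_const (b : n → ℝ) (c : ℝ) (G : Matrix n m ℝ) :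
    outCov b (fun _ => c) G = diagonal b + c • (G * Gᵀ) := by
  have h : (diagonal (fun _ => c) : Matrix m m ℝ) = c • (1 : Matrix m m ℝ) := by
    rw [smul_one_eq_diagonal]
  rw [outCov, h, Matrix.mul_smul, Matrix.mul_one, Matrix.smul_mul]

theorem trace_mono_mul_transpose {σ : n → m} (hσ : Function.Injective σ) (g : n → ℝ) :
    (mono σ g * (mono σ g)ᵀ).trace = ∑ i, g i ^ 2 := by
  have := mono_mul_diagonal_mul_transpose hσ g (fun _ => 1)
  rw [diagonal_one, Matrix.mul_one] at this
  simp [this, trace_diagonal]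

/-- The gain of a single subchannel with signal-to-noise ratio `l`, the quotient of its power and
its noise variance. -/
def pairGain (c a l : ℝ) : ℝ := Real.log (1 + (c + a) * l) - Real.log (1 + c * l)

theorem logDetGain_mono {σ : n → m} (hσ : Function.Injective σ) {b : n → ℝ} {a : m → ℝ} {c : ℝ}
    (hb : ∀ i, 0 < b i) (ha : ∀ j, 0 ≤ a j) (hc : 0 < c) (g : n → ℝ) :
    logDetGain b a c (mono σ g) = ∑ i, pairGain c (a (σ i)) (g i ^ 2 / b i) := by
  have key (e : m → ℝ) (he : ∀ j, 0 ≤ e j) : Real.log (outCov b e (mono σ g)).det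
      = ∑ i, (Real.log (b i) + Real.log (1 + e (σ i) * (g i ^ 2 / b i))) := by
    have h1 (i : n) : 0 < 1 + e (σ i) * (g i ^ 2 / b i) := by
      have := he (σ i)
      have := hb i
      positivity
    rw [outCov_mono hσ, det_diagonal, Real.log_prod]
    · refine Finset.sum_congr rfl fun i _ => ?_
      rw [← Real.log_mul (hb i).ne' (h1 i).ne']
      congr 1
      have := (hb i).ne'
      field_simp
    · intro i _
      have := he (σ i)
      have := hb i
      positivity
  rw [logDetGain, key _ fun j => add_nonneg hc.le (ha j), key _ fun _ => hc.le,
    ← Finset.sum_sub_distrib]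
  refine Finset.sum_congr rfl fun i _ => ?_
  rw [pairGain]
  ring

/-- The first-order condition at the nonzero entry of row `i`. -/
theorem mono_multiplier {σ : n → m} (hσ : Function.Injective σ) {b : n → ℝ} {a : m → ℝ} {c ν : ℝ}
    (hb : ∀ i, 0 < b i) (ha : ∀ j, 0 ≤ a j) (hc : 0 < c) {g : n → ℝ}
    (hν : gainGrad b a c (mono σ g) = ν • mono σ g) {i : n} (hi : g i ≠ 0) :
    a (σ i) * b i = ν * ((b i + (c + a (σ i)) * g i ^ 2) * (b i + c * g i ^ 2)) := by
  have hinv (e : m → ℝ) (he : ∀ j, 0 ≤ e j) : logDetGrad b e (mono σ g) i (σ i)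
      = (b i + e (σ i) * g i ^ 2)⁻¹ * g i * e (σ i) := by
    have hne (k : n) : b k + e (σ k) * g k ^ 2 ≠ 0 := by
      have := he (σ k)
      have := hb k
      positivity
    have : (outCov b e (mono σ g))⁻¹ = diagonal fun i => (b i + e (σ i) * g i ^ 2)⁻¹ := by
      rw [outCov_mono hσ]
      refine inv_eq_left_inv ?_
      rw [diagonal_mul_diagonal, ← diagonal_one]
      congr 1
      funext k
      exact inv_mul_cancel₀ (hne k)
    rw [logDetGrad, this, mul_diagonal, diagonal_mul]
    simp [mono]
  have h := congrFun (congrFun hν i) (σ i)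
  rw [gainGrad, Matrix.sub_apply, hinv _ fun j => add_nonneg hc.le (ha j), hinv _ fun _ => hc.le,
    Matrix.smul_apply, smul_eq_mul] at h
  have hm : mono σ g i (σ i) = g i := by simp [mono]
  rw [hm] at h
  have h1 : b i + (c + a (σ i)) * g i ^ 2 ≠ 0 := by
    have := ha (σ i)
    have := hb i
    positivity
  have h2 : b i + c * g i ^ 2 ≠ 0 := by
    have := hb i
    positivity
  field_simp at h
  linear_combination h

/-- A matrix that satisfies the first-order conditions is monomial: its rows are orthogonal, and the
nonzero entries of a row sit at columns with equal, nonzero values of `a`, hence at one column. -/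
theorem exists_eq_mono (hcard : Fintype.card n ≤ Fintype.card m) {b : n → ℝ} {a : m → ℝ}
    {c ν : ℝ} (hb : ∀ i, 0 < b i) (hbinj : Function.Injective b) (ha : ∀ j, 0 ≤ a j)
    (ha_distinct : ∀ i j, a i ≠ 0 → a i = a j → i = j) (hc : 0 < c) (hν0 : 0 < ν)
    {G : Matrix n m ℝ} (hν : gainGrad b a c G = ν • G) :
    ∃ (σ : n → m) (g : n → ℝ), Function.Injective σ ∧ G = mono σ g := by
  set X := outCov b (fun j => c + a j) G with hX
  set Y := outCov b (fun _ => c) G with hY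
  have hXpd : X.PosDef := outCov_posDef hb (fun j => add_nonneg hc.le (ha j)) G
  have hYpd : Y.PosDef := outCov_posDef hb (fun _ => hc.le) G
  have hXu : IsUnit X.det := hXpd.det_pos.ne'.isUnit
  have hYu : IsUnit Y.det := hYpd.det_pos.ne'.isUnit
  have hsymm {A : Matrix n n ℝ} (hA : A.PosDef) : (A⁻¹)ᵀ = A⁻¹ := by
    simpa [IsHermitian] using hA.inv.isHermitian
  have h1 : ν • (G * Gᵀ) = (Y⁻¹ - X⁻¹) * diagonal b := by
    rw [← gainGrad_mul_transpose hb ha hc G, hν, Matrix.smul_mul]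
  -- both `G * Gᵀ` and `Y⁻¹ - X⁻¹` are symmetric, so they commute with `diagonal b`
  have h2 : (Y⁻¹ - X⁻¹) * diagonal b = diagonal b * (Y⁻¹ - X⁻¹) := by
    have := congrArg transpose h1
    rw [transpose_smul, transpose_mul, transpose_mul, transpose_transpose, h1, transpose_sub,
      hsymm hXpd, hsymm hYpd, diagonal_transpose] at this
    exact this
  have hW (i k : n) (hik : i ≠ k) : (Y⁻¹ - X⁻¹) i k = 0 := by
    have := congrFun (congrFun h2 i) k
    rw [mul_diagonal, diagonal_mul] at this
    have hne : b k - b i ≠ 0 := sub_ne_zero.2 fun h => hik (hbinj h.symm)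
    have h3 : (b k - b i) * (Y⁻¹ - X⁻¹) i k = 0 := by linear_combination this
    exact (mul_eq_zero.1 h3).resolve_left hne
  have hK (i k : n) (hik : i ≠ k) : (G * Gᵀ) i k = 0 := by
    have := congrFun (congrFun h1 i) k
    rw [mul_diagonal, hW i k hik, zero_mul, Matrix.smul_apply, smul_eq_mul] at this
    exact (mul_eq_zero.1 this).resolve_left hν0.ne'
  have hYd : Y = diagonal fun i => b i + c * (G * Gᵀ) i i := by
    ext i k
    rw [hY, outCov_const]
    by_cases h : i = k
    · subst h; simp
    · simp [h, hK i k h]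
  have hYi : Y⁻¹ = diagonal fun i => (b i + c * (G * Gᵀ) i i)⁻¹ := by
    have hne (i : n) : b i + c * (G * Gᵀ) i i ≠ 0 := by
      have := hYpd.diag_pos (i := i)
      rw [hYd, diagonal_apply_eq] at this
      exact this.ne'
    refine inv_eq_left_inv ?_
    rw [hYd, diagonal_mul_diagonal, ← diagonal_one]
    congr 1
    funext k
    exact inv_mul_cancel₀ (hne k)
  set x : n → ℝ := fun i => X⁻¹ i i with hx
  have hXi : X⁻¹ = diagonal x := by
    ext i k
    by_cases h : i = k
    · subst h; simp [hx]
    · have h3 := hW i k h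
      rw [Matrix.sub_apply, hYi, diagonal_apply_ne _ h] at h3
      rw [diagonal_apply_ne _ h]
      linarith
  have hxpos (i : n) : 0 < x i := hXpd.inv.diag_pos
  have hXd : X = diagonal fun i => (x i)⁻¹ := by
    rw [← nonsing_inv_nonsing_inv X hXu, hXi]
    refine inv_eq_left_inv ?_
    rw [diagonal_mul_diagonal, ← diagonal_one]
    congr 1
    funext k
    exact inv_mul_cancel₀ (hxpos k).ne'
  -- the nonzero entries of row `i` sit at columns where `a` has a common value
  have hent (i : n) (j : m) (hij : G i j ≠ 0) :
      (c + a j) * x i = c * (b i + c * (G * Gᵀ) i i)⁻¹ + ν := by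
    have h3 := congrFun (congrFun hν i) j
    rw [gainGrad, logDetGrad, logDetGrad, ← hX, ← hY, hXi, hYi, Matrix.sub_apply, mul_diagonal,
      mul_diagonal, diagonal_mul, diagonal_mul, Matrix.smul_apply, smul_eq_mul] at h3
    have : G i j * ((c + a j) * x i - (c * (b i + c * (G * Gᵀ) i i)⁻¹ + ν)) = 0 := by
      linear_combination h3
    linarith [(mul_eq_zero.1 this).resolve_left hij]
  have hcol (i : n) (j l : m) (hij : G i j ≠ 0) (hil : G i l ≠ 0) : j = l := by
    have haeq : a j = a l := by
      have h3 := (hent i j hij).trans (hent i l hil).symm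
      linarith [mul_right_cancel₀ (hxpos i).ne' h3]
    by_cases haj : a j = 0
    · exfalso
      -- then the row only sees the zero part of `a`, so `X i i = Y i i`
      have hzero (k : m) : a k * G i k ^ 2 = 0 := by
        by_cases hk : G i k = 0
        · simp [hk]
        · have h3 := (hent i j hij).trans (hent i k hk).symm
          have := mul_right_cancel₀ (hxpos i).ne' h3
          rw [show a k = 0 by linarith, zero_mul]
      have hXY : X i i = Y i i := by
        rw [hX, hY, outCov, outCov, Matrix.add_apply, Matrix.add_apply, mul_apply, mul_apply]
        congr 1
        refine Finset.sum_congr rfl fun k _ => ?_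
        rw [mul_diagonal, mul_diagonal, transpose_apply]
        linear_combination hzero k
      rw [hXd, hYd, diagonal_apply_eq, diagonal_apply_eq] at hXY
      have h4 := hent i j hij
      rw [haj, ← hXY, inv_inv] at h4
      linarith
    · exact ha_distinct j l haj haeq
  -- the columns of the nonzero rows, extended injectively to the zero rows
  classical
  set A : Finset n := Finset.univ.filter fun i => ∃ j, G i j ≠ 0
  have hne : ∀ i : n, ∃ j : m, i ∈ A → G i j ≠ 0 := by
    intro i
    by_cases hi : i ∈ A
    · obtain ⟨j, hj⟩ := (Finset.mem_filter.1 hi).2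
      exact ⟨j, fun _ => hj⟩
    · have : Nonempty m := Fintype.card_pos_iff.1
        (lt_of_lt_of_le (Fintype.card_pos_iff.2 ⟨i⟩) hcard)
      exact ⟨Classical.arbitrary m, fun h => absurd h hi⟩
  choose f hf using hne
  have hrow (i : n) (j : m) (h : G i j ≠ 0) : i ∈ A ∧ j = f i := by
    have hi : i ∈ A := Finset.mem_filter.2 ⟨Finset.mem_univ _, j, h⟩
    exact ⟨hi, hcol i j (f i) h (hf i hi)⟩
  have hfinj : Set.InjOn f A := by
    intro i hi k hk hik
    by_contra hne
    have h3 := hK i k hne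
    rw [mul_apply, Finset.sum_eq_single (f i)] at h3
    · rw [transpose_apply, mul_eq_zero] at h3
      rcases h3 with h3 | h3
      · exact hf i hi h3
      · rw [hik] at h3
        exact hf k hk h3
    · intro j _ hj
      by_contra h4
      exact hj (hrow i j (left_ne_zero_of_mul h4)).2
    · simp
  obtain ⟨B, hAB, -, hB⟩ := Finset.exists_subsuperset_card_eq (n := Fintype.card n)
    (Finset.subset_univ (A.image f)) (Finset.card_image_le.trans (Finset.card_le_univ A))
    (by simpa using hcard)
  obtain ⟨e, he⟩ := Finset.exists_equiv_extend_of_card_eq hB.symm hAB hfinj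
  refine ⟨fun i => e i, fun i => G i (e i), fun i k h => e.injective (Subtype.ext h), ?_⟩
  ext i j
  by_cases h : G i j = 0
  · by_cases hj : j = e i
    · simp [mono, ← hj]
    · simp [mono, hj, h]
  · obtain ⟨hi, hj⟩ := hrow i j h
    have : j = e i := hj.trans (he i hi).symm
    simp [mono, ← this]

end Monomial

/-! ### Exchange arguments and existence of maximizers -/

section Matching

variable {n m : Type*} [Fintype n] [DecidableEq n] [Fintype m] [DecidableEq m]

theorem IsMaximizer.of_le {b : n → ℝ} {a : m → ℝ} {c P : ℝ} {G H : Matrix n m ℝ}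
    (hG : IsMaximizer b a c P G) (hH : (H * Hᵀ).trace ≤ P)
    (h : logDetGain b a c G ≤ logDetGain b a c H) : IsMaximizer b a c P H :=
  ⟨hH, fun K hK => (hG.2 K hK).trans h⟩

theorem pairGain_zero (c a : ℝ) : pairGain c a 0 = 0 := by simp [pairGain]

theorem pairGain_lt {c a a' l : ℝ} (hc : 0 < c) (ha : 0 ≤ a) (haa : a < a') (hl : 0 < l) :
    pairGain c a l < pairGain c a' l := by
  unfold pairGain
  gcongr

theorem pairGain_nonneg {c a l : ℝ} (hc : 0 < c) (ha : 0 ≤ a) (hl : 0 ≤ l) :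
    0 ≤ pairGain c a l := by
  unfold pairGain
  rw [sub_nonneg]
  gcongr
  linarith

/-- Rearrangement: it is better to pair the larger `a` with the larger ratio. -/
theorem pairGain_swap_le {c a a' l l' : ℝ} (hc : 0 < c) (ha : 0 ≤ a) (haa : a ≤ a') (hl : 0 ≤ l)
    (hll : l ≤ l') :
    pairGain c a' l + pairGain c a l' ≤ pairGain c a l + pairGain c a' l' := by
  have hl' : 0 ≤ l' := hl.trans hll
  have ha' : 0 ≤ a' := ha.trans haa
  have h1 : 0 < 1 + (c + a') * l := by positivity
  have h2 : 0 < 1 + (c + a) * l' := by positivity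
  have h3 : 0 < 1 + (c + a) * l := by positivity
  have h4 : 0 < 1 + (c + a') * l' := by positivity
  have key : Real.log (1 + (c + a') * l) + Real.log (1 + (c + a) * l') ≤
      Real.log (1 + (c + a) * l) + Real.log (1 + (c + a') * l') := by
    rw [← Real.log_mul h1.ne' h2.ne', ← Real.log_mul h3.ne' h4.ne']
    apply Real.log_le_log (by positivity)
    nlinarith [mul_nonneg (sub_nonneg.2 haa) (sub_nonneg.2 hll)]
  unfold pairGain
  linarith

variable {b : n → ℝ} {a : m → ℝ} {c P : ℝ} {σ : n → m} {g : n → ℝ}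

/-- Rows with less noise have the larger signal-to-noise ratio. Otherwise exchange the columns of
two rows together with their ratios: the gain stays the same and the power drops, so a maximizer
would not use the whole power. -/
theorem IsMaximizer.level_le (hb : ∀ i, 0 < b i) (ha : ∀ j, 0 ≤ a j) (hc : 0 < c)
    (hσ : Function.Injective σ) (hG : IsMaximizer b a c P (mono σ g))
    (hpos : 0 < logDetGain b a c (mono σ g)) {i k : n} (hik : b i < b k) :
    g k ^ 2 / b k ≤ g i ^ 2 / b i := by
  by_contra! hlt
  set s := Equiv.swap i k
  have hne : i ≠ k := by rintro rfl; exact lt_irrefl _ hik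
  set g' : n → ℝ := fun j => Real.sqrt (b j * (g (s j) ^ 2 / b (s j))) with hg'
  have hsq (j : n) : g' j ^ 2 = b j * (g (s j) ^ 2 / b (s j)) := by
    apply Real.sq_sqrt
    have := hb j
    have := hb (s j)
    positivity
  have hgain : logDetGain b a c (mono (σ ∘ s) g') = logDetGain b a c (mono σ g) := by
    rw [logDetGain_mono (hσ.comp s.injective) hb ha hc, logDetGain_mono hσ hb ha hc,
      ← Equiv.sum_comp s]
    refine Finset.sum_congr rfl fun j _ => ?_
    rw [hsq, Function.comp_apply, show s (s j) = j from Equiv.swap_apply_self i k j,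
      mul_div_cancel_left₀ _ (hb (s j)).ne']
  have htr : ∑ j, g' j ^ 2 < ∑ j, g j ^ 2 := by
    rw [← Equiv.sum_comp s, ← sub_neg, ← Finset.sum_sub_distrib]
    have hterm (j : n) : g' (s j) ^ 2 - g j ^ 2 = (b (s j) - b j) * (g j ^ 2 / b j) := by
      have := (hb j).ne'
      rw [hsq, show s (s j) = j from Equiv.swap_apply_self i k j]
      field_simp
    simp_rw [hterm]
    rw [Fintype.sum_eq_add i k hne]
    · simp only [s, Equiv.swap_apply_left, Equiv.swap_apply_right]
      nlinarith
    · rintro j ⟨hj1, hj2⟩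
      simp [s, Equiv.swap_apply_of_ne_of_ne hj1 hj2]
  have hfeas := hG.1
  rw [trace_mono_mul_transpose hσ] at hfeas
  have hmax : IsMaximizer b a c P (mono (σ ∘ s) g') := hG.of_le
    (by rw [trace_mono_mul_transpose (hσ.comp s.injective)]; linarith) hgain.ge
  obtain ⟨ν, -, -, h⟩ := hmax.exists_multiplier hb ha hc (hgain ▸ hpos)
  rw [trace_mono_mul_transpose (hσ.comp s.injective)] at h
  linarith

/-- No column left idle has a larger `a` than a column in use: moving a row there increases the
gain. -/
theorem IsMaximizer.le_of_unused (hb : ∀ i, 0 < b i) (ha : ∀ j, 0 ≤ a j) (hc : 0 < c)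
    (hσ : Function.Injective σ) (hG : IsMaximizer b a c P (mono σ g)) {i : n} (hi : g i ≠ 0)
    {j : m} (hj : ∀ k, g k ≠ 0 → σ k ≠ j) : a j ≤ a (σ i) := by
  by_contra! hlt
  set σ' : n → m := Equiv.swap j (σ i) ∘ σ with hσ'
  have hinj : Function.Injective σ' := (Equiv.injective _).comp hσ
  have hfeas := hG.1
  rw [trace_mono_mul_transpose hσ, ← trace_mono_mul_transpose hinj] at hfeas
  refine (hG.2 _ hfeas).not_gt ?_
  rw [logDetGain_mono hinj hb ha hc, logDetGain_mono hσ hb ha hc]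
  have hi' : pairGain c (a (σ i)) (g i ^ 2 / b i) < pairGain c (a (σ' i)) (g i ^ 2 / b i) := by
    have : σ' i = j := by simp [hσ']
    rw [this]
    have := hb i
    exact pairGain_lt hc (ha _) hlt (by positivity)
  refine Finset.sum_lt_sum (fun k _ => ?_) ⟨i, Finset.mem_univ _, hi'⟩
  by_cases hki : k = i
  · subst hki
    exact hi'.le
  · by_cases hk : g k = 0
    · simp [hk, pairGain_zero]
    · have : σ' k = σ k := by
        simp [hσ', Equiv.swap_apply_of_ne_of_ne (hj k hk) (hσ.ne hki)]
      rw [this]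

/-- Of two rows in use, the one with the larger signal-to-noise ratio has the larger `a`. Otherwise
exchanging their columns, with the powers kept, does not lower the gain and gives another
maximizer. Its multiplier would have to be larger than the old one by the first-order condition at
one of the two rows and smaller by that at the other. The comparison of the gains alone would not
exclude equal ratios. -/
theorem IsMaximizer.le_of_level_le (hb : ∀ i, 0 < b i) (ha : ∀ j, 0 ≤ a j) (hc : 0 < c)
    (hσ : Function.Injective σ) (hG : IsMaximizer b a c P (mono σ g))
    (hpos : 0 < logDetGain b a c (mono σ g)) {i k : n} (hi : g i ≠ 0) (hk : g k ≠ 0)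
    (hlev : g k ^ 2 / b k ≤ g i ^ 2 / b i) : a (σ k) ≤ a (σ i) := by
  by_contra! hlt
  have hne : i ≠ k := by rintro rfl; exact lt_irrefl _ hlt
  have hbi := hb i
  have hbk := hb k
  set σ' : n → m := σ ∘ Equiv.swap i k with hσ'
  have hinj : Function.Injective σ' := hσ.comp (Equiv.injective _)
  have hi' : σ' i = σ k := by simp [hσ']
  have hk' : σ' k = σ i := by simp [hσ']
  have hgain : logDetGain b a c (mono σ g) ≤ logDetGain b a c (mono σ' g) := by
    rw [logDetGain_mono hinj hb ha hc, logDetGain_mono hσ hb ha hc, ← sub_nonneg,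
      ← Finset.sum_sub_distrib, Fintype.sum_eq_add i k hne]
    · rw [hi', hk']
      have := pairGain_swap_le hc (ha (σ i)) hlt.le (by positivity) hlev
      linarith
    · rintro j ⟨hj1, hj2⟩
      simp [hσ', Equiv.swap_apply_of_ne_of_ne hj1 hj2]
  have hfeas := hG.1
  rw [trace_mono_mul_transpose hσ, ← trace_mono_mul_transpose hinj] at hfeas
  have hmax := hG.of_le hfeas hgain
  obtain ⟨ν, hν0, hν, -⟩ := hG.exists_multiplier hb ha hc hpos
  obtain ⟨ν', hν0', hν', -⟩ := hmax.exists_multiplier hb ha hc (hpos.trans_le hgain)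
  -- at the same noise and power, a larger value of `a` means a larger multiplier
  have key {x y s s' B p : ℝ} (hB : 0 < B) (hp : 0 < p) (hx : 0 ≤ x) (hxy : x < y)
      (h1 : x * B = s * ((B + (c + x) * p) * (B + c * p)))
      (h2 : y * B = s' * ((B + (c + y) * p) * (B + c * p))) : s < s' := by
    have hD1 : 0 < (B + (c + x) * p) * (B + c * p) := by positivity
    have hy : 0 < y := hx.trans_lt hxy
    have hD2 : 0 < (B + (c + y) * p) * (B + c * p) := by positivity
    rw [eq_comm, ← eq_div_iff hD1.ne'] at h1
    rw [eq_comm, ← eq_div_iff hD2.ne'] at h2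
    rw [h1, h2, div_lt_div_iff₀ hD1 hD2]
    have : 0 < (y - x) * (B * (B + c * p) * (B + c * p)) :=
      mul_pos (sub_pos.2 hxy) (by positivity)
    linear_combination this
  have e1 := mono_multiplier hσ hb ha hc hν hi
  have e2 := mono_multiplier hσ hb ha hc hν hk
  have e3 := mono_multiplier hinj hb ha hc hν' hi
  have e4 := mono_multiplier hinj hb ha hc hν' hk
  rw [hi'] at e3
  rw [hk'] at e4
  exact lt_asymm (key hbi (by positivity) (ha _) hlt e1 e3)
    (key hbk (by positivity) (ha _) hlt e4 e2)

theorem IsMaximizer.pos_of_ne_zero (hb : ∀ i, 0 < b i) (ha : ∀ j, 0 ≤ a j) (hc : 0 < c)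
    (hσ : Function.Injective σ) (hG : IsMaximizer b a c P (mono σ g))
    (hpos : 0 < logDetGain b a c (mono σ g)) {i : n} (hi : g i ≠ 0) : 0 < a (σ i) := by
  obtain ⟨ν, hν0, hν, -⟩ := hG.exists_multiplier hb ha hc hpos
  have h := mono_multiplier hσ hb ha hc hν hi
  have := ha (σ i)
  have hbi := hb i
  have : 0 < a (σ i) * b i := by
    rw [h]
    positivity
  exact (pos_iff_pos_of_mul_pos this).2 hbi

/-- The gain is continuous on the compact set of feasible matrices. -/
theorem exists_isMaximizer (hb : ∀ i, 0 < b i) (ha : ∀ j, 0 ≤ a j) (hc : 0 < c) (hP : 0 ≤ P) :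
    ∃ G, IsMaximizer b a c P G := by
  have hcont (e : m → ℝ) (he : ∀ j, 0 ≤ e j) :
      Continuous fun G : Matrix n m ℝ => Real.log (outCov b e G).det := by
    refine Continuous.log ?_ fun G => (outCov_posDef hb he G).det_pos.ne'
    unfold outCov
    fun_prop
  have hgain : Continuous (logDetGain (n := n) b a c) :=
    (hcont _ fun j => add_nonneg hc.le (ha j)).sub (hcont _ fun _ => hc.le)
  have hcompact : IsCompact {G : Matrix n m ℝ | (G * Gᵀ).trace ≤ P} := by
    have hbox : IsCompact (Set.univ.pi fun _ : n => Set.univ.pi fun _ : m =>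
        Set.Icc (-Real.sqrt P) (Real.sqrt P)) :=
      isCompact_univ_pi fun _ => isCompact_univ_pi fun _ => isCompact_Icc
    refine IsCompact.of_isClosed_subset hbox (isClosed_le ?_ continuous_const) ?_
    · exact (by fun_prop : Continuous fun G : Matrix n m ℝ => (G * Gᵀ).trace)
    · intro G hG i _ j _
      rw [Set.mem_ofPred_eq, trace_mul_transpose_self_eq] at hG
      have h1 : G i j ^ 2 ≤ ∑ j, G i j ^ 2 :=
        Finset.single_le_sum (f := fun j => G i j ^ 2) (fun _ _ => sq_nonneg _) (Finset.mem_univ j)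
      have h2 : ∑ j, G i j ^ 2 ≤ ∑ i, ∑ j, G i j ^ 2 :=
        Finset.single_le_sum (f := fun i => ∑ j, G i j ^ 2)
          (fun _ _ => Finset.sum_nonneg fun _ _ => sq_nonneg _) (Finset.mem_univ i)
      exact abs_le.1 (Real.abs_le_sqrt (h1.trans (h2.trans hG)))
  obtain ⟨G, hG, hmax⟩ := hcompact.exists_isMaxOn ⟨0, by simpa using hP⟩ hgain.continuousOn
  exact ⟨G, hG, fun H hH => hmax hH⟩

/-- The tangent line inequality: the gain of a subchannel, as a function of its power `p`, lies
below the line of slope `ν` through its value at `w`, and meets it at `w` only. Here `w` satisfies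
the first-order condition for `ν`, with an inequality if `w = 0`. The proof applies `log x ≤ x - 1`
to the quotient of the arguments of the logarithms. -/
theorem pairGain_sub_le {c a b p w ν : ℝ} (hc : 0 < c) (ha : 0 ≤ a) (hb : 0 < b) (hp : 0 ≤ p)
    (hw : 0 ≤ w) (hν : 0 < ν) (hactive : 0 < w → a * b = ν * ((b + (c + a) * w) * (b + c * w)))
    (hinactive : w = 0 → a ≤ ν * b) :
    pairGain c a (p / b) - pairGain c a (w / b) ≤ ν * (p - w) ∧
      (pairGain c a (p / b) - pairGain c a (w / b) = ν * (p - w) → p = w) := by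
  have h1 : 0 < b + (c + a) * p := by positivity
  have h2 : 0 < b + c * p := by positivity
  have h3 : 0 < b + (c + a) * w := by positivity
  have h4 : 0 < b + c * w := by positivity
  have hform (x : ℝ) (hx : 0 ≤ x) :
      pairGain c a (x / b) = Real.log (b + (c + a) * x) - Real.log (b + c * x) := by
    rw [pairGain, show 1 + (c + a) * (x / b) = (b + (c + a) * x) / b by field_simp,
      show 1 + c * (x / b) = (b + c * x) / b by field_simp, Real.log_div (by positivity) hb.ne',
      Real.log_div (by positivity) hb.ne']
    ring
  have hlog : pairGain c a (p / b) - pairGain c a (w / b)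
      ≤ a * b * (p - w) / ((b + c * p) * (b + (c + a) * w)) := by
    have h5 := Real.log_le_sub_one_of_pos
      (show 0 < ((b + (c + a) * p) * (b + c * w)) / ((b + c * p) * (b + (c + a) * w)) by positivity)
    rw [Real.log_div (by positivity) (by positivity), Real.log_mul h1.ne' h4.ne',
      Real.log_mul h2.ne' h3.ne'] at h5
    rw [hform p hp, hform w hw]
    have h6 : ((b + (c + a) * p) * (b + c * w)) / ((b + c * p) * (b + (c + a) * w)) - 1
        = a * b * (p - w) / ((b + c * p) * (b + (c + a) * w)) := by
      rw [div_sub_one (by positivity)]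
      congr 1
      ring
    linarith
  -- the gap in the linear bound is at least `ν c (p - w)² / (b + c p)`
  have hquad : a * b * (p - w) / ((b + c * p) * (b + (c + a) * w))
      ≤ ν * (p - w) - ν * c * (p - w) ^ 2 / (b + c * p) := by
    rw [sub_eq_add_neg (ν * (p - w)), ← neg_div, div_add' _ _ _ h2.ne' |> (add_comm _ _).trans,
      div_le_div_iff₀ (by positivity) h2]
    rcases hw.eq_or_lt with h0 | h0
    · subst h0
      have := hinactive rfl
      have h7 : 0 ≤ (ν * b - a) * (p * b * (b + c * p)) :=
        mul_nonneg (by linarith) (by positivity)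
      linear_combination h7
    · rw [hactive h0]
      apply le_of_eq
      ring
  have hgap : 0 ≤ ν * c * (p - w) ^ 2 / (b + c * p) := by positivity
  refine ⟨by linarith, fun h => ?_⟩
  have h8 : ν * c * (p - w) ^ 2 / (b + c * p) = 0 := by linarith
  rw [div_eq_zero_iff, or_iff_left h2.ne', mul_eq_zero, or_iff_right (by positivity)] at h8
  exact sub_eq_zero.1 (pow_eq_zero_iff (two_ne_zero) |>.1 h8)

end Matching

/-! ### The maximizers are diagonal, and their powers -/

section Sorted

variable {t q : ℕ} {b : Fin t → ℝ} {a : Fin q → ℝ} {c P ν : ℝ}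

theorem rectDiag_eq_mono (htq : t ≤ q) (d : Fin t → ℝ) :
    rectDiag q d = mono (Fin.castLE htq) d := by
  ext i j
  simp only [rectDiag, mono, of_apply, Fin.ext_iff, Fin.val_castLE]
  exact if_congr eq_comm rfl rfl

/-- A maximizer is monomial, and by the exchange arguments a row in use is matched with the column
of its own index: by induction, the smaller columns belong to the smaller rows, and a larger column
has a smaller `a` than the diagonal one, which is either idle or used by a later row. -/
theorem IsMaximizer.exists_eq_rectDiag (htq : t ≤ q) (hb : ∀ i, 0 < b i) (hbm : StrictMono b)
    (ha : ∀ j, 0 ≤ a j) (ham : Antitone a) (ha_distinct : ∀ i j, i < j → a i ≠ 0 → a j ≠ a i)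
    (hc : 0 < c) {G : Matrix (Fin t) (Fin q) ℝ} (hG : IsMaximizer b a c P G)
    (hpos : 0 < logDetGain b a c G) : ∃ d, G = rectDiag q d := by
  have hinj : ∀ i j, a i ≠ 0 → a i = a j → i = j := by
    intro i j hi hij
    rcases lt_trichotomy i j with h | h | h
    · exact absurd hij.symm (ha_distinct i j h hi)
    · exact h
    · exact absurd hij (ha_distinct j i h (hij ▸ hi))
  obtain ⟨ν, hν0, hν, -⟩ := hG.exists_multiplier hb ha hc hpos
  obtain ⟨σ, g, hσ, rfl⟩ := exists_eq_mono (by simpa using htq) hb hbm.injective ha hinj hc hν0 hν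
  have hlev {i k : Fin t} (hik : i < k) : g k ^ 2 / b k ≤ g i ^ 2 / b i :=
    hG.level_le hb ha hc hσ hpos (hbm hik)
  have hprefix {i k : Fin t} (hik : i < k) (hk : g k ≠ 0) : g i ≠ 0 := by
    intro hi
    have h1 := hlev hik
    have := hb k
    have h2 : 0 < g k ^ 2 / b k := by positivity
    rw [hi] at h1
    simp only [ne_eq, OfNat.ofNat_ne_zero, not_false_eq_true, zero_pow, zero_div] at h1
    linarith
  have hfix : ∀ i : Fin t, g i ≠ 0 → σ i = Fin.castLE htq i := by
    intro i
    induction i using WellFoundedLT.induction with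
    | ind i ih =>
      intro hi
      have hapos : 0 < a (σ i) := hG.pos_of_ne_zero hb ha hc hσ hpos hi
      by_contra hne
      have hgt : Fin.castLE htq i < σ i := by
        refine lt_of_le_of_ne ?_ (Ne.symm hne)
        by_contra! hlt
        have hlt' : (σ i : ℕ) < i := hlt
        have h1 := ih ⟨σ i, hlt'.trans i.2⟩ hlt' (hprefix hlt' hi)
        have h2 : σ ⟨σ i, hlt'.trans i.2⟩ = σ i := h1.trans (Fin.ext rfl)
        have h3 := congrArg Fin.val (hσ h2)
        simp only at h3
        omega
      have hlt : a (σ i) < a (Fin.castLE htq i) := by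
        refine lt_of_le_of_ne (ham hgt.le) fun h => ?_
        exact hgt.ne' (hinj _ _ hapos.ne' h)
      by_cases hused : ∀ k, g k ≠ 0 → σ k ≠ Fin.castLE htq i
      · exact hlt.not_ge (hG.le_of_unused hb ha hc hσ hi hused)
      · push Not at hused
        obtain ⟨k, hk, hki⟩ := hused
        rcases lt_trichotomy k i with h | h | h
        · have h1 := (ih k h hk).symm.trans hki
          exact h.ne (Fin.castLE_injective htq h1)
        · subst h
          exact hne hki
        · have h1 := hG.le_of_level_le hb ha hc hσ hpos hi hk (hlev h)
          rw [hki] at h1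
          exact hlt.not_ge h1
  refine ⟨g, ?_⟩
  rw [rectDiag_eq_mono htq]
  ext i j
  by_cases hi : g i = 0
  · simp [mono, hi]
  · simp [mono, hfix i hi]

/-- If powers `w` exhaust `P` and satisfy the first-order conditions for `ν`, the maximizers are the
diagonal matrices with these powers. Necessity is the equality case of the tangent line inequality.
Sufficiency follows, because a maximizer exists, so has these powers, and the gain of a diagonal
matrix depends on the powers alone. -/
theorem isMaximizer_iff (ht : 0 < t) (htq : t ≤ q) (hb : ∀ i, 0 < b i) (hbm : StrictMono b)
    (ha : ∀ j, 0 ≤ a j) (ham : Antitone a) (ha_distinct : ∀ i j, i < j → a i ≠ 0 → a j ≠ a i)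
    (ha_ne : ∃ i, a i ≠ 0) (hc : 0 < c) (hP : 0 < P) (hν : 0 < ν) {w : Fin t → ℝ}
    (hw : ∀ i, 0 ≤ w i) (hsum : ∑ i, w i = P)
    (hactive : ∀ i, 0 < w i → a (Fin.castLE htq i) * b i
      = ν * ((b i + (c + a (Fin.castLE htq i)) * w i) * (b i + c * w i)))
    (hinactive : ∀ i, w i = 0 → a (Fin.castLE htq i) ≤ ν * b i) (G : Matrix (Fin t) (Fin q) ℝ) :
    IsMaximizer b a c P G ↔ ∃ d : Fin t → ℝ, (∀ i, d i ^ 2 = w i) ∧ G = rectDiag q d := by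
  have hσ := Fin.castLE_injective htq
  have hgain (d : Fin t → ℝ) := logDetGain_mono hσ hb ha hc d
  have htr (d : Fin t → ℝ) := trace_mono_mul_transpose hσ d
  set i₀ : Fin t := ⟨0, ht⟩
  have ha0 : 0 < a (Fin.castLE htq i₀) := by
    obtain ⟨i, hi⟩ := ha_ne
    exact ((ha i).lt_of_ne' hi).trans_le (ham (Nat.zero_le _))
  -- the whole power on the first subchannel already gives a positive gain
  have hpos {H : Matrix (Fin t) (Fin q) ℝ} (hH : IsMaximizer b a c P H) :
      0 < logDetGain b a c H := by
    set d : Fin t → ℝ := Pi.single i₀ (Real.sqrt P)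
    have hd : ∑ i, d i ^ 2 = P := by
      rw [Finset.sum_eq_single i₀]
      · simp [d, Real.sq_sqrt hP.le]
      · intro j _ hj
        simp [d, hj]
      · simp
    refine lt_of_lt_of_le ?_ (hH.2 (mono (Fin.castLE htq) d) (by rw [htr, hd]))
    rw [hgain]
    have hbi (i : Fin t) : 0 ≤ d i ^ 2 / b i := div_nonneg (sq_nonneg _) (hb i).le
    refine Finset.sum_pos' (fun i _ => pairGain_nonneg hc (ha _) (hbi i))
      ⟨i₀, Finset.mem_univ _, ?_⟩
    have h1 : 0 < d i₀ ^ 2 / b i₀ := by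
      have := hb i₀
      simp only [d, Pi.single_eq_same, Real.sq_sqrt hP.le]
      positivity
    have h2 := pairGain_lt hc le_rfl ha0 h1
    have h3 := pairGain_nonneg hc le_rfl h1.le
    linarith
  have hforward {H : Matrix (Fin t) (Fin q) ℝ} (hH : IsMaximizer b a c P H) :
      ∃ d : Fin t → ℝ, (∀ i, d i ^ 2 = w i) ∧ H = rectDiag q d := by
    obtain ⟨d, rfl⟩ := hH.exists_eq_rectDiag htq hb hbm ha ham ha_distinct hc (hpos hH)
    refine ⟨d, ?_, rfl⟩
    rw [rectDiag_eq_mono htq] at hH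
    set d' : Fin t → ℝ := fun i => Real.sqrt (w i)
    have hd' (i) : d' i ^ 2 = w i := Real.sq_sqrt (hw i)
    have h1 := hH.2 (mono (Fin.castLE htq) d') (by simp [htr, hd', hsum])
    have h2 := hH.1
    rw [hgain, hgain] at h1
    rw [htr] at h2
    simp only [hd'] at h1
    have htan (i : Fin t) := pairGain_sub_le hc (ha (Fin.castLE htq i)) (hb i) (sq_nonneg (d i))
      (hw i) hν (hactive i) (hinactive i)
    have h3 : ∑ i, (pairGain c (a (Fin.castLE htq i)) (d i ^ 2 / b i)
        - pairGain c (a (Fin.castLE htq i)) (w i / b i)) = ∑ i, ν * (d i ^ 2 - w i) := by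
      refine le_antisymm (Finset.sum_le_sum fun i _ => (htan i).1) ?_
      rw [← Finset.mul_sum, Finset.sum_sub_distrib, Finset.sum_sub_distrib, hsum]
      nlinarith
    have h4 := (Finset.sum_eq_sum_iff_of_le fun i _ => (htan i).1).1 h3
    exact fun i => (htan i).2 (h4 i (Finset.mem_univ i))
  refine ⟨hforward, ?_⟩
  rintro ⟨d, hd, rfl⟩
  obtain ⟨H, hH⟩ := exists_isMaximizer (n := Fin t) (m := Fin q) hb ha hc hP.le
  obtain ⟨d', hd', rfl⟩ := hforward hH
  rw [rectDiag_eq_mono htq] at hH ⊢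
  refine hH.of_le (by simp [htr, hd, hsum]) ?_
  rw [hgain, hgain]
  simp [hd, hd']

end Sorted

/-! ### The water level -/

section WaterLevel

variable {c b a μ : ℝ}

theorem waterLevel_pos_iff (hc : 0 < c) (hb : 0 < b) (ha : 0 ≤ a) (hμ : 0 < μ) :
    0 < waterLevel c b a μ ↔ 2 * μ * b < a := by
  have h1 : 0 < b / (2 * c * (c + a)) := by positivity
  rw [waterLevel, mul_pos_iff_of_pos_left h1, neg_add_eq_sub, sub_pos,
    Real.lt_sqrt (by positivity)]
  have h2 : (2 * c + a) ^ 2 = a ^ 2 + 4 * c * (c + a) := by ring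
  rw [h2, add_lt_add_iff_left, lt_div_iff₀ (by positivity), mul_lt_mul_iff_right₀ (by positivity)]

/-- The water level is the nonnegative root of the first-order condition for `ν = 2 μ`. -/
theorem waterLevel_eq_iff (hc : 0 < c) (hb : 0 < b) (ha : 0 ≤ a) (hμ : 0 < μ) {w : ℝ}
    (hw : 0 ≤ w) :
    waterLevel c b a μ = w ↔ a * b = 2 * μ * ((b + (c + a) * w) * (b + c * w)) := by
  have h1 : 0 < b / (2 * c * (c + a)) := by positivity
  rw [waterLevel, mul_comm, ← eq_div_iff h1.ne', neg_add_eq_iff_eq_add, eq_comm,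
    eq_comm (b := Real.sqrt _), Real.sqrt_eq_iff_mul_self_eq (by positivity) (by positivity)]
  field_simp
  constructor
  · intro h
    apply mul_left_cancel₀ (show 4 * c * (c + a) ≠ 0 by positivity)
    linear_combination h
  · intro h
    linear_combination (4 * c * (c + a)) * h

theorem waterLevel_lt (hc : 0 < c) (hb : 0 < b) (ha : 0 < a) (hμ : 0 < μ) {μ' : ℝ} (h : μ < μ') :
    waterLevel c b a μ' < waterLevel c b a μ := by
  have hμ' := hμ.trans h
  unfold waterLevel
  gcongr

theorem continuousOn_waterLevel (hb : 0 < b) :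
    ContinuousOn (waterLevel c b a) (Set.Ioi 0) := by
  unfold waterLevel
  refine ContinuousOn.mul continuousOn_const (continuousOn_const.add ?_)
  refine (continuousOn_const.add (continuousOn_const.div (by fun_prop) ?_)).sqrt
  intro μ hμ
  have : (0 : ℝ) < μ := hμ
  positivity

end WaterLevel

/-! ### The multiplier and the number of active subchannels -/

section Multiplier

variable {t q : ℕ} {b : Fin t → ℝ} {a : Fin q → ℝ} {c P : ℝ}

/-- The power used with multiplier `μ`, where subchannels with a negative water level are idle. -/
def totalPower (htq : t ≤ q) (b : Fin t → ℝ) (a : Fin q → ℝ) (c μ : ℝ) : ℝ :=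
  ∑ i : Fin t, max 0 (waterLevel c (b i) (a (Fin.castLE htq i)) μ)

/-- The total power is strictly decreasing in `μ` as long as it is positive, and the intermediate
value theorem applies between a multiplier which spends at least `P` and one which spends
nothing. -/
theorem existsUnique_totalPower_eq (ht : 0 < t) (htq : t ≤ q) (hb : ∀ i, 0 < b i)
    (ha : ∀ j, 0 ≤ a j) (ham : Antitone a) (ha_ne : ∃ i, a i ≠ 0) (hc : 0 < c) (hP : 0 < P) :
    ∃! μ : ℝ, 0 < μ ∧ totalPower htq b a c μ = P := by
  set i₀ : Fin t := ⟨0, ht⟩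
  set w : Fin t → ℝ → ℝ := fun i => waterLevel c (b i) (a (Fin.castLE htq i)) 
  have ha0 : 0 < a (Fin.castLE htq i₀) := by
    obtain ⟨i, hi⟩ := ha_ne
    exact ((ha i).lt_of_ne' hi).trans_le (ham (Nat.zero_le _))
  have hlt {μ μ' : ℝ} (hμ : 0 < μ) (h : μ < μ') (hpos : 0 < totalPower htq b a c μ') :
      totalPower htq b a c μ' < totalPower htq b a c μ := by
    have hterm (i : Fin t) : max 0 (w i μ') ≤ max 0 (w i μ) ∧
        (0 < w i μ' → max 0 (w i μ') < max 0 (w i μ)) := by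
      have key : 0 < w i μ' → w i μ' < w i μ := fun hi => by
        have hμ' := hμ.trans h
        have hbi := hb i
        have h1 := (waterLevel_pos_iff hc hbi (ha _) hμ').1 hi
        exact waterLevel_lt hc hbi (lt_trans (by positivity) h1) hμ h
      constructor
      · rcases le_or_gt (w i μ') 0 with hi | hi
        · rw [max_eq_left hi]
          exact le_max_left _ _
        · exact max_le_max le_rfl (key hi).le
      · intro hi
        rw [max_eq_right hi.le]
        exact (key hi).trans_le (le_max_right _ _)
    obtain ⟨i, -, hi⟩ := Finset.exists_lt_of_sum_lt
      (show ∑ _i : Fin t, (0 : ℝ) < ∑ i, max 0 (w i μ') by simpa [totalPower] using hpos)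
    have hi' : 0 < w i μ' := (lt_max_iff.1 hi).resolve_left (lt_irrefl _)
    exact Finset.sum_lt_sum (fun i _ => (hterm i).1) ⟨i, Finset.mem_univ _, (hterm i).2 hi'⟩
  -- at `μ₁` the first subchannel alone uses the whole power
  set A := a (Fin.castLE htq i₀)
  set B := b i₀
  have hB : 0 < B := hb i₀
  set D := (B + (c + A) * P) * (B + c * P) with hD
  have hD0 : 0 < D := by positivity
  set μ₁ := A * B / (2 * D) with hμ₁
  have hμ₁0 : 0 < μ₁ := by positivity
  have h1 : P ≤ totalPower htq b a c μ₁ := by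
    have h2 : w i₀ μ₁ = P := by
      refine (waterLevel_eq_iff hc hB ha0.le hμ₁0 hP.le).2 ?_
      rw [← hD, hμ₁]
      field_simp
    calc P = max 0 (w i₀ μ₁) := by rw [h2, max_eq_right hP.le]
      _ ≤ _ := Finset.single_le_sum (f := fun i => max 0 (w i μ₁)) (fun _ _ => le_max_left _ _)
        (Finset.mem_univ i₀)
  -- at `μ₂` no subchannel is active
  set μ₂ := μ₁ + ∑ i, A / (2 * b i)
  have hnn (i : Fin t) : 0 ≤ A / (2 * b i) := by
    have := hb i
    positivity
  have hμ₁₂ : μ₁ ≤ μ₂ := le_add_of_nonneg_right (Finset.sum_nonneg fun i _ => hnn i)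
  have h2 : totalPower htq b a c μ₂ = 0 := by
    refine Finset.sum_eq_zero fun i _ => max_eq_left ?_
    have hbi := hb i
    rw [← not_lt, waterLevel_pos_iff hc (hb i) (ha _) (hμ₁0.trans_le hμ₁₂), not_lt]
    have h3 : A / (2 * b i) ≤ μ₂ := by
      have := Finset.single_le_sum (f := fun i => A / (2 * b i)) (fun i _ => hnn i)
        (Finset.mem_univ i)
      linarith
    have h4 : a (Fin.castLE htq i) ≤ A := ham (Nat.zero_le _)
    rw [div_le_iff₀ (by positivity)] at h3
    linarith
  have hcont : ContinuousOn (totalPower htq b a c) (Set.Icc μ₁ μ₂) := by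
    refine continuousOn_finsetSum _ fun i _ => continuousOn_const.sup ?_
    exact (continuousOn_waterLevel (hb i)).mono fun x hx => hμ₁0.trans_le hx.1
  obtain ⟨μ, hμ, hμP⟩ := intermediate_value_Icc' hμ₁₂ hcont ⟨h2 ▸ hP.le, h1⟩
  refine ⟨μ, ⟨hμ₁0.trans_le hμ.1, hμP⟩, ?_⟩
  rintro μ' ⟨hμ', hμ'P⟩
  rcases lt_trichotomy μ' μ with h | h | h
  · have := hlt hμ' h (hμP ▸ hP)
    linarith
  · exact h
  · have := hlt (hμ₁0.trans_le hμ.1) h (hμ'P ▸ hP)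
    linarith

/-- The bound by the rank in `IsActiveCount` never cuts off an active subchannel. -/
theorem lt_rank_diagonal (ham : Antitone a) {j : Fin q} (hj : 0 < a j) :
    (j : ℕ) < (diagonal a).rank := by
  rw [rank_diagonal, Fintype.card_subtype]
  have hsub : Finset.Iic j ⊆ Finset.univ.filter fun i => a i ≠ 0 := by
    intro i hi
    exact Finset.mem_filter.2 ⟨Finset.mem_univ _, (hj.trans_le (ham (Finset.mem_Iic.1 hi))).ne'⟩
  have := Finset.card_le_card hsub
  rw [Fin.card_Iic] at this
  omega

/-- The first `κ` subchannels are exactly the active ones, since activity `2 μ b i < a i` is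
inherited by smaller indices. -/
theorem IsActiveCount.lt_iff (htq : t ≤ q) (hb : ∀ i, 0 < b i) (hbm : StrictMono b)
    (ha : ∀ j, 0 ≤ a j) (ham : Antitone a) (hc : 0 < c) {μ : ℝ} (hμ : 0 < μ) {κ : ℕ}
    (hκ : IsActiveCount (fun i : Fin t => waterLevel c (b i) (a (Fin.castLE htq i)) μ)
      (diagonal a).rank κ) (i : Fin t) :
    (i : ℕ) < κ ↔ 0 < waterLevel c (b i) (a (Fin.castLE htq i)) μ := by
  refine ⟨fun h => hκ.1.2.2.2 i h, fun h => ?_⟩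
  have h1 := (waterLevel_pos_iff hc (hb i) (ha _) hμ).1 h
  have hbi := hb i
  refine Nat.lt_of_succ_le (hκ.2 ⟨Nat.succ_pos _, ?_, i.2, ?_⟩)
  · exact lt_rank_diagonal ham (j := Fin.castLE htq i) (lt_trans (by positivity) h1)
  · intro k hk
    have hki : k ≤ i := Nat.lt_succ_iff.1 hk
    rw [waterLevel_pos_iff hc (hb k) (ha _) hμ]
    have h2 : a (Fin.castLE htq i) ≤ a (Fin.castLE htq k) := ham (by exact hki)
    have h3 : b k ≤ b i := hbm.monotone hki
    nlinarith

theorem exists_isActiveCount (htq : t ≤ q) (hb : ∀ i, 0 < b i) (hbm : StrictMono b)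
    (ha : ∀ j, 0 ≤ a j) (ham : Antitone a) (hc : 0 < c) {μ : ℝ} (hμ : 0 < μ)
    (hpos : 0 < totalPower htq b a c μ) :
    ∃ κ, IsActiveCount (fun i : Fin t => waterLevel c (b i) (a (Fin.castLE htq i)) μ)
      (diagonal a).rank κ := by
  obtain ⟨i, -, hi⟩ := Finset.exists_lt_of_sum_lt
    (show ∑ _i : Fin t, (0 : ℝ) < ∑ i, max 0 (waterLevel c (b i) (a (Fin.castLE htq i)) μ) by
      simpa [totalPower] using hpos)
  have hi' := (waterLevel_pos_iff hc (hb i) (ha _) hμ).1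
    ((lt_max_iff.1 hi).resolve_left (lt_irrefl _))
  set i₀ : Fin t := ⟨0, i.pos⟩
  have h2 : a (Fin.castLE htq i) ≤ a (Fin.castLE htq i₀) := ham (Nat.zero_le _)
  have h3 : b i₀ ≤ b i := hbm.monotone (Nat.zero_le _)
  have h0 : 2 * μ * b i₀ < a (Fin.castLE htq i₀) := by nlinarith
  have hb0 := hb i₀
  refine Nat.sSup_mem ?_ ⟨t, fun k hk => hk.2.2.1⟩ |> fun h => ⟨_, h, fun k hk => ?_⟩
  · refine ⟨1, le_rfl, ?_, i.pos, ?_⟩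
    · exact lt_rank_diagonal ham (j := Fin.castLE htq i₀) (lt_trans (by positivity) h0)
    · intro k hk
      have : k = i₀ := Fin.ext (Nat.lt_one_iff.1 hk)
      rw [this]
      exact (waterLevel_pos_iff hc (hb _) (ha _) hμ).2 h0
  · exact le_csSup ⟨t, fun k hk => hk.2.2.1⟩ hk

theorem IsActiveCount.ite_eq_max (htq : t ≤ q) (hb : ∀ i, 0 < b i) (hbm : StrictMono b)
    (ha : ∀ j, 0 ≤ a j) (ham : Antitone a) (hc : 0 < c) {μ : ℝ} (hμ : 0 < μ) {κ : ℕ}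
    (hκ : IsActiveCount (fun i : Fin t => waterLevel c (b i) (a (Fin.castLE htq i)) μ)
      (diagonal a).rank κ) (i : Fin t) :
    (if (i : ℕ) < κ then waterLevel c (b i) (a (Fin.castLE htq i)) μ else 0)
      = max 0 (waterLevel c (b i) (a (Fin.castLE htq i)) μ) := by
  have h := hκ.lt_iff htq hb hbm ha ham hc hμ i
  split_ifs with hi
  · exact (max_eq_right (h.1 hi).le).symm
  · exact (max_eq_left (not_lt.1 fun h' => hi (h.2 h'))).symm

theorem existsUnique_multiplier (ht : 0 < t) (htq : t ≤ q) (hb : ∀ i, 0 < b i)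
    (hbm : StrictMono b) (ha : ∀ j, 0 ≤ a j) (ham : Antitone a) (ha_ne : ∃ i, a i ≠ 0)
    (hc : 0 < c) (hP : 0 < P) :
    ∃! μ : ℝ, 0 < μ ∧ ∃ κ : ℕ,
      IsActiveCount (fun i : Fin t => waterLevel c (b i) (a (Fin.castLE htq i)) μ)
        (diagonal a).rank κ ∧
      ∑ i : Fin t, (if (i : ℕ) < κ then waterLevel c (b i) (a (Fin.castLE htq i)) μ else 0)
        = P := by
  refine (existsUnique_congr fun μ => and_congr_right fun hμ => ?_).1
    (existsUnique_totalPower_eq ht htq hb ha ham ha_ne hc hP)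
  constructor
  · intro h
    obtain ⟨κ, hκ⟩ := exists_isActiveCount htq hb hbm ha ham hc hμ (h ▸ hP)
    refine ⟨κ, hκ, ?_⟩
    rw [← h]
    exact Finset.sum_congr rfl fun i _ => hκ.ite_eq_max htq hb hbm ha ham hc hμ i
  · rintro ⟨κ, hκ, h⟩
    rw [← h]
    exact Finset.sum_congr rfl fun i _ => (hκ.ite_eq_max htq hb hbm ha ham hc hμ i).symm

theorem isMaximizer_iff_waterLevel (ht : 0 < t) (htq : t ≤ q) (hb : ∀ i, 0 < b i)
    (hbm : StrictMono b) (ha : ∀ j, 0 ≤ a j) (ham : Antitone a)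
    (ha_distinct : ∀ i j, i < j → a i ≠ 0 → a j ≠ a i) (ha_ne : ∃ i, a i ≠ 0)
    (hc : 0 < c) (hP : 0 < P) {μ : ℝ} (hμ : 0 < μ) {κ : ℕ}
    (hκ : IsActiveCount (fun i : Fin t => waterLevel c (b i) (a (Fin.castLE htq i)) μ)
      (diagonal a).rank κ)
    (hsum : ∑ i : Fin t, (if (i : ℕ) < κ then waterLevel c (b i) (a (Fin.castLE htq i)) μ else 0)
      = P) (G : Matrix (Fin t) (Fin q) ℝ) :
    IsMaximizer b a c P G ↔ ∃ d : Fin t → ℝ,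
      (∀ i, d i ^ 2 = if (i : ℕ) < κ then waterLevel c (b i) (a (Fin.castLE htq i)) μ else 0) ∧
      G = rectDiag q d := by
  have hmax := hκ.ite_eq_max htq hb hbm ha ham hc hμ
  simp_rw [hmax] at hsum ⊢
  refine isMaximizer_iff ht htq hb hbm ha ham ha_distinct ha_ne hc hP (ν := 2 * μ) (by positivity)
    (fun i => le_max_left _ _) hsum (fun i hi => ?_) (fun i hi => ?_) G
  · have h1 := (lt_max_iff.1 hi).resolve_left (lt_irrefl _)
    rw [max_eq_right h1.le]
    exact (waterLevel_eq_iff hc (hb i) (ha _) hμ h1.le).1 rfl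
  · by_contra! h
    have h1 := (waterLevel_pos_iff hc (hb i) (ha _) hμ).2 h
    exact (lt_max_of_lt_right h1).ne' hi

end Multiplier

/-! ### Densities of Gaussian vectors -/

section GaussianDensity

variable {ι : Type*} [Fintype ι]

variable (ι) in
/-- The standard Gaussian law on `ι → ℝ`, the product of standard normal laws. -/
def stdLaw : Measure (ι → ℝ) := Measure.pi fun _ => gaussianReal 0 1

instance : IsProbabilityMeasure (stdLaw ι) := by
  unfold stdLaw
  infer_instance

theorem iIndepFun_stdLaw : iIndepFun (fun (i : ι) (x : ι → ℝ) => x i) (stdLaw ι) :=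
  iIndepFun_pi (X := fun _ : ι => (id : ℝ → ℝ)) fun _ => aemeasurable_id

theorem map_eval_stdLaw (i : ι) : (stdLaw ι).map (fun x => x i) = gaussianReal 0 1 :=
  (measurePreserving_eval (fun _ : ι => gaussianReal 0 1) i).map_eq

theorem hasGaussianLaw_stdLaw : HasGaussianLaw (fun x : ι → ℝ => x) (stdLaw ι) :=
  iIndepFun_stdLaw.hasGaussianLaw fun i => ⟨by rw [map_eval_stdLaw]; infer_instance⟩

/-- The density of `stdLaw ι` with respect to Lebesgue measure. -/
def stdDensity (x : ι → ℝ) : ℝ := ∏ i, gaussianPDFReal 0 1 (x i)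

theorem stdDensity_pos (x : ι → ℝ) : 0 < stdDensity x :=
  Finset.prod_pos fun i _ => gaussianPDFReal_pos 0 1 (x i) one_ne_zero

theorem measurable_stdDensity : Measurable (stdDensity (ι := ι)) :=
  Finset.measurable_prod _ fun i _ =>
    (measurable_gaussianPDFReal 0 1).comp (measurable_pi_apply i)

theorem stdLaw_eq_withDensity :
    stdLaw ι = volume.withDensity fun x => ENNReal.ofReal (stdDensity x) := by
  refine Measure.pi_eq fun s hs => ?_
  have hint (i : ι) : Integrable ((s i).indicator (gaussianPDFReal 0 1)) :=
    (integrable_gaussianPDFReal 0 1).indicator (hs i)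
  rw [withDensity_apply _ (MeasurableSet.univ_pi hs),
    ← lintegral_indicator (MeasurableSet.univ_pi hs)]
  have hind : (Set.univ.pi s).indicator (fun x : ι → ℝ => ENNReal.ofReal (stdDensity x))
      = fun x => ENNReal.ofReal (∏ i, (s i).indicator (gaussianPDFReal 0 1) (x i)) := by
    funext x
    by_cases hx : x ∈ Set.univ.pi s
    · rw [Set.indicator_of_mem hx, stdDensity]
      congr 1
      exact Finset.prod_congr rfl fun i _ => (Set.indicator_of_mem (hx i trivial) _).symm
    · rw [Set.indicator_of_notMem hx]
      obtain ⟨i, hi⟩ : ∃ i, x i ∉ s i := by simpa [Set.mem_pi] using hx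
      rw [Finset.prod_eq_zero (Finset.mem_univ i) (Set.indicator_of_notMem hi _),
        ENNReal.ofReal_zero]
  rw [hind, volume_pi, ← ofReal_integral_eq_lintegral_ofReal (Integrable.fintype_prod hint)
    (Filter.Eventually.of_forall fun x => Finset.prod_nonneg fun i _ =>
      Set.indicator_nonneg (fun y _ => gaussianPDFReal_nonneg 0 1 y) _),
    integral_fintype_prod_eq_prod, ENNReal.ofReal_prod_of_nonneg]
  · refine Finset.prod_congr rfl fun i _ => ?_
    rw [gaussianReal_apply_eq_integral _ one_ne_zero, integral_indicator (hs i)]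
  · exact fun i _ => integral_nonneg fun y =>
      Set.indicator_nonneg (fun y _ => gaussianPDFReal_nonneg 0 1 y) _

theorem integrable_log_stdDensity :
    Integrable (fun x : ι → ℝ => Real.log (stdDensity x)) (stdLaw ι) := by
  have h1 : (fun x : ι → ℝ => Real.log (stdDensity x))
      = fun x => ∑ i, Real.log (gaussianPDFReal 0 1 (x i)) := by
    funext x
    exact Real.log_prod fun i _ => (gaussianPDFReal_pos 0 1 (x i) one_ne_zero).ne'
  have h2 : Integrable (fun y : ℝ => Real.log (gaussianPDFReal 0 1 y)) (gaussianReal 0 1) := by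
    have h3 : (fun y : ℝ => Real.log (gaussianPDFReal 0 1 y))
        = fun y => Real.log (Real.sqrt (2 * Real.pi))⁻¹ + (-1 / 2) * y ^ 2 := by
      funext y
      rw [gaussianPDFReal, Real.log_mul (by positivity) (Real.exp_pos _).ne', Real.log_exp]
      simp
      ring
    rw [h3]
    refine (integrable_const _).add (Integrable.const_mul ?_ _)
    exact (memLp_id_gaussianReal (μ := 0) (v := 1) 2).integrable_sq
  rw [h1]
  exact integrable_finsetSum _ fun i _ =>
    integrable_comp_eval (μ := fun _ : ι => gaussianReal 0 1) h2

/-- Push-forward of a density along a map with a measurable left inverse. -/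
theorem map_withDensity_of_leftInverse {α β : Type*} [MeasurableSpace α] [MeasurableSpace β]
    {μ : Measure α} {T : α → β} {S : β → α} (hT : Measurable T) (hS : Measurable S)
    (hST : Function.LeftInverse S T) {f : α → ENNReal} (hf : Measurable f) :
    (μ.withDensity f).map T = (μ.map T).withDensity (f ∘ S) := by
  ext s hs
  rw [Measure.map_apply hT hs, withDensity_apply _ (hT hs), withDensity_apply _ hs,
    setLIntegral_map hs (hf.comp hS) hT]
  simp only [Function.comp_apply, hST _]

theorem map_affine_stdLaw [DecidableEq ι] {L : Matrix ι ι ℝ} (hL : L.det ≠ 0) (m : ι → ℝ) :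
    (stdLaw ι).map (fun x => m + L *ᵥ x) = volume.withDensity fun z =>
      ENNReal.ofReal (|L.det|⁻¹ * stdDensity (L⁻¹ *ᵥ (z - m))) := by
  have hT : Measurable fun x : ι → ℝ => m + L *ᵥ x := by fun_prop
  have hS : Measurable fun z : ι → ℝ => L⁻¹ *ᵥ (z - m) := by fun_prop
  have hST : Function.LeftInverse (fun z : ι → ℝ => L⁻¹ *ᵥ (z - m)) fun x => m + L *ᵥ x := by
    intro x
    simp [mulVec_mulVec, nonsing_inv_mul _ hL.isUnit]
  have hvol : (volume : Measure (ι → ℝ)).map (fun x => m + L *ᵥ x)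
      = ENNReal.ofReal |L.det|⁻¹ • volume := by
    have h1 : (fun x : ι → ℝ => m + L *ᵥ x) = (fun y => m + y) ∘ toLin' L := by
      funext x
      simp
    rw [h1, ← Measure.map_map (by fun_prop)
        (by exact (toLin' L).continuous_of_finiteDimensional.measurable),
      Real.map_matrix_volume_pi_eq_smul_volume_pi hL, Measure.map_smul,
      map_add_left_eq_self, abs_inv]
  rw [stdLaw_eq_withDensity, map_withDensity_of_leftInverse hT hS hST
    measurable_stdDensity.ennreal_ofReal, hvol, withDensity_smul_measure,
    ← withDensity_smul _ (measurable_stdDensity.ennreal_ofReal.comp hS)]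
  congr 1
  funext z
  simp only [Pi.smul_apply, Function.comp_apply, smul_eq_mul]
  rw [← ENNReal.ofReal_mul (by positivity)]

end GaussianDensity

/-! ### Gaussian laws as affine images of the standard one -/

section GaussianLaw

variable {Ω Ω' : Type*} [MeasurableSpace Ω] [MeasurableSpace Ω'] {Pr : Measure Ω} {Pr' : Measure Ω'}
  {ι : Type*} [Fintype ι] [DecidableEq ι]

/-- Gaussian vectors with the same means and covariances have the same law, as their characteristic
functions agree. -/
theorem map_eq_of_gaussian {X : Ω → ι → ℝ} {Y : Ω' → ι → ℝ} (hX : HasGaussianLaw X Pr)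
    (hY : HasGaussianLaw Y Pr') (hmean : ∀ i, ∫ ω, X ω i ∂Pr = ∫ ω, Y ω i ∂Pr')
    (hcov : ∀ i j, cov[fun ω => X ω i, fun ω => X ω j; Pr]
      = cov[fun ω => Y ω i, fun ω => Y ω j; Pr']) :
    Pr.map X = Pr'.map Y := by
  have := hX.isProbabilityMeasure
  have := hY.isProbabilityMeasure
  have := hX.isGaussian_map
  have := hY.isGaussian_map
  have hXi (i : ι) : MemLp (fun ω => X ω i) 2 Pr := (hX.eval i).memLp_two
  have hYi (i : ι) : MemLp (fun ω => Y ω i) 2 Pr' := (hY.eval i).memLp_two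
  refine Measure.ext_of_charFunDual ?_
  funext L
  have hLsum (x : ι → ℝ) : L x = ∑ i, L (Pi.single i 1) * x i := by
    conv_lhs => rw [← Finset.univ_sum_single x]
    rw [map_sum]
    refine Finset.sum_congr rfl fun i _ => ?_
    rw [mul_comm, ← smul_eq_mul, ← map_smul]
    congr 1
    rw [← Pi.single_smul, smul_eq_mul, mul_one]
  rw [hX.charFunDual_map_eq_fun, hY.charFunDual_map_eq_fun]
  have h1 : ∫ ω, ∑ i, L (Pi.single i 1) * X ω i ∂Pr = ∫ ω, ∑ i, L (Pi.single i 1) * Y ω i ∂Pr' := by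
    rw [integral_finsetSum _ fun i _ => ((hXi i).integrable one_le_two).const_mul _,
      integral_finsetSum _ fun i _ => ((hYi i).integrable one_le_two).const_mul _]
    simp_rw [integral_const_mul, hmean]
  have h2 : Var[fun ω => ∑ i, L (Pi.single i 1) * X ω i; Pr]
      = Var[fun ω => ∑ i, L (Pi.single i 1) * Y ω i; Pr'] := by
    rw [variance_fun_sum fun i => (hXi i).const_mul _,
      variance_fun_sum fun i => (hYi i).const_mul _]
    simp_rw [covariance_const_mul_left, covariance_const_mul_right, hcov]
  rw [funext fun ω => hLsum (X ω), funext fun ω => hLsum (Y ω), h1, h2]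

theorem covariance_stdLaw (i j : ι) :
    cov[fun x : ι → ℝ => x i, fun x => x j; stdLaw ι] = (1 : Matrix ι ι ℝ) i j := by
  by_cases h : i = j
  · subst h
    have h1 := variance_map (X := id) (μ := stdLaw ι) (Y := fun x : ι → ℝ => x i)
      aemeasurable_id (measurable_pi_apply i).aemeasurable
    rw [map_eval_stdLaw, variance_id_gaussianReal] at h1
    rw [covariance_self (measurable_pi_apply i).aemeasurable, one_apply_eq]
    exact h1.symm
  · rw [one_apply_ne h]
    exact (iIndepFun_stdLaw.indepFun h).covariance_eq_zero
      (hasGaussianLaw_stdLaw.eval i).memLp_two (hasGaussianLaw_stdLaw.eval j).memLp_two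

open scoped MatrixOrder in
/-- A Gaussian vector with positive definite covariance `C` has the law of `m + L x` for a standard
Gaussian `x`, where `C = L Lᵀ`. -/
theorem exists_map_eq_affine {X : Ω → ι → ℝ} (hX : HasGaussianLaw X Pr) {C : Matrix ι ι ℝ}
    (hC : C.PosDef) (hcov : ∀ i j, cov[fun ω => X ω i, fun ω => X ω j; Pr] = C i j) :
    ∃ (L : Matrix ι ι ℝ) (m : ι → ℝ), L.det ≠ 0 ∧ Real.log C.det = 2 * Real.log |L.det| ∧
      Pr.map X = (stdLaw ι).map fun x => m + L *ᵥ x := by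
  obtain ⟨B, hB⟩ := CStarAlgebra.nonneg_iff_eq_star_mul_self.mp hC.posSemidef.nonneg
  have hB' : C = Bᵀ * (Bᵀ)ᵀ := by
    rw [hB, star_eq_conjTranspose, conjTranspose_eq_transpose_of_trivial, transpose_transpose]
  have hdet : C.det = (Bᵀ).det ^ 2 := by
    rw [hB', det_mul, det_transpose (Bᵀ), pow_two]
  set L := Bᵀ
  have hev (i : ι) : MemLp (fun x : ι → ℝ => x i) 2 (stdLaw ι) :=
    (hasGaussianLaw_stdLaw.eval i).memLp_two
  set m : ι → ℝ := fun i => ∫ ω, X ω i ∂Pr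
  have hLx (i : ι) : MemLp (fun x : ι → ℝ => (L *ᵥ x) i) 2 (stdLaw ι) :=
    memLp_finsetSum _ fun j _ => (hev j).const_mul _
  have hgauss : HasGaussianLaw (fun x : ι → ℝ => m + L *ᵥ x) (stdLaw ι) := by
    have h1 := (hasGaussianLaw_stdLaw (ι := ι)).map (LinearMap.toContinuousLinearMap (toLin' L))
    have := h1.isGaussian_map
    refine ⟨?_⟩
    have h2 : (fun x : ι → ℝ => m + L *ᵥ x)
        = (fun y => m + y) ∘ (LinearMap.toContinuousLinearMap (toLin' L) ∘ fun x : ι → ℝ => x) := by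
      funext x
      simp
    rw [h2, ← Measure.map_map (by fun_prop) (by fun_prop)]
    infer_instance
  refine ⟨L, m, fun h => ?_, ?_, map_eq_of_gaussian hX hgauss (fun i => ?_) fun i j => ?_⟩
  · rw [h, zero_pow two_ne_zero] at hdet
    exact hC.det_pos.ne' hdet
  · rw [hdet, ← sq_abs, Real.log_pow]
    norm_num
  · have h0 : ∫ x : ι → ℝ, (L *ᵥ x) i ∂(stdLaw ι) = 0 := by
      simp only [mulVec, dotProduct]
      rw [integral_finsetSum _ fun j _ => ((hev j).integrable one_le_two).const_mul _]
      refine Finset.sum_eq_zero fun j _ => ?_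
      rw [integral_const_mul, stdLaw, integral_eval, integral_id_gaussianReal, mul_zero]
    simp only [Pi.add_apply]
    rw [integral_add (integrable_const _) ((hLx i).integrable one_le_two), h0]
    simp [m]
  · simp only [Pi.add_apply]
    rw [covariance_const_add_left ((hLx i).integrable one_le_two),
      covariance_const_add_right ((hLx j).integrable one_le_two), hcov, hB']
    simp only [mulVec, dotProduct]
    rw [covariance_fun_sum_fun_sum (fun k => (hev k).const_mul _) fun k => (hev k).const_mul _]
    simp_rw [covariance_const_mul_left, covariance_const_mul_right, covariance_stdLaw, mul_apply,
      transpose_apply, one_apply]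
    simp

end GaussianLaw

/-! ### Mutual information of a linear Gaussian channel -/

section ChannelInfo

variable {Ω : Type*} [MeasurableSpace Ω] {Pr : Measure Ω}
  {κ ι : Type*} [Fintype κ] [Fintype ι] [DecidableEq ι]

/-- A Gaussian vector `X` with covariance `C` has a positive density `f`, and `log f (X)` is
integrable with expectation `-(log det C) / 2` up to a constant that depends on the dimension only.
The constant cancels in mutual information and need not be computed. -/
theorem exists_density {X : Ω → ι → ℝ} (hX : HasGaussianLaw X Pr) {C : Matrix ι ι ℝ}
    (hC : C.PosDef) (hcov : ∀ i j, cov[fun ω => X ω i, fun ω => X ω j; Pr] = C i j) :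
    ∃ f : (ι → ℝ) → ℝ, Measurable f ∧ (∀ z, 0 < f z) ∧
      Pr.map X = volume.withDensity (fun z => ENNReal.ofReal (f z)) ∧
      Integrable (fun ω => Real.log (f (X ω))) Pr ∧
      ∫ ω, Real.log (f (X ω)) ∂Pr
        = (∫ x : ι → ℝ, Real.log (stdDensity x) ∂(stdLaw ι)) - Real.log C.det / 2 := by
  obtain ⟨L, m, hL, hdet, hmap⟩ := exists_map_eq_affine hX hC hcov
  have habs : 0 < |L.det| := abs_pos.2 hL
  set f : (ι → ℝ) → ℝ := fun z => |L.det|⁻¹ * stdDensity (L⁻¹ *ᵥ (z - m)) with hf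
  have hfm : Measurable f := (measurable_stdDensity.comp (by fun_prop)).const_mul _
  have hT : Measurable fun x : ι → ℝ => m + L *ᵥ x := by fun_prop
  have hlog (x : ι → ℝ) :
      Real.log (f (m + L *ᵥ x)) = -Real.log |L.det| + Real.log (stdDensity x) := by
    have : L⁻¹ *ᵥ (m + L *ᵥ x - m) = x := by
      simp [mulVec_mulVec, nonsing_inv_mul _ hL.isUnit]
    rw [hf]
    simp only [this]
    rw [Real.log_mul (inv_pos.2 habs).ne' (stdDensity_pos x).ne', Real.log_inv]
  have hlogm : Measurable fun z => Real.log (f z) := Real.measurable_log.comp hfm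
  have hint : Integrable (fun x => -Real.log |L.det| + Real.log (stdDensity x)) (stdLaw ι) :=
    (integrable_const _).add integrable_log_stdDensity
  refine ⟨f, hfm, fun z => mul_pos (inv_pos.2 habs) (stdDensity_pos _), ?_, ?_, ?_⟩
  · rw [hmap, map_affine_stdLaw hL]
  · have h1 : Integrable (fun z => Real.log (f z)) (Pr.map X) := by
      rw [hmap, integrable_map_measure hlogm.aestronglyMeasurable hT.aemeasurable]
      exact hint.congr (Filter.Eventually.of_forall fun x => (hlog x).symm)
    exact (integrable_map_measure hlogm.aestronglyMeasurable hX.aemeasurable).1 h1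
  · rw [← integral_map (φ := X) (f := fun z => Real.log (f z)) hX.aemeasurable
      hlogm.aestronglyMeasurable, hmap, integral_map hT.aemeasurable hlogm.aestronglyMeasurable]
    simp_rw [hlog]
    rw [integral_add (integrable_const _) integrable_log_stdDensity, hdet]
    simp
    ring

/-- The mutual information of the input and the output of `z = A θ + n` with Gaussian noise `n`
independent of `θ`. The input need not have a density: relative to the product of the law of `θ`
and Lebesgue measure, which is invariant under `(θ, n) ↦ (θ, A θ + n)`, the joint law of `θ` and `z`
has the density `f (z - A θ)`, and the product of the marginals the density `g z`. -/
theorem toReal_mutualInfo_channel {θ : Ω → κ → ℝ} {z n : Ω → ι → ℝ} {A : Matrix ι κ ℝ}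
    (hz : ∀ ω, z ω = A *ᵥ θ ω + n ω) (hθ : AEMeasurable θ Pr) (hnG : HasGaussianLaw n Pr)
    (hzG : HasGaussianLaw z Pr) (hind : IndepFun θ n Pr) {N S : Matrix ι ι ℝ} (hN : N.PosDef)
    (hS : S.PosDef) (hncov : ∀ i j, cov[fun ω => n ω i, fun ω => n ω j; Pr] = N i j)
    (hzcov : ∀ i j, cov[fun ω => z ω i, fun ω => z ω j; Pr] = S i j) :
    (mutualInfo Pr θ z).toReal = (Real.log S.det - Real.log N.det) / 2 := by
  have := hnG.isProbabilityMeasure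
  obtain ⟨f, hfm, hf0, hf, hfi, hfint⟩ := exists_density hnG hN hncov
  obtain ⟨g, hgm, hg0, hg, hgi, hgint⟩ := exists_density hzG hS hzcov
  have hθprob : IsProbabilityMeasure (Pr.map θ) := Measure.isProbabilityMeasure_map hθ
  have hzprob : IsProbabilityMeasure (Pr.map z) := Measure.isProbabilityMeasure_map hzG.aemeasurable
  have hzθ : AEMeasurable (fun ω => (θ ω, z ω)) Pr := hθ.prodMk hzG.aemeasurable
  have hJprob : IsProbabilityMeasure (Pr.map fun ω => (θ ω, z ω)) :=
    Measure.isProbabilityMeasure_map hzθ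
  set T : (κ → ℝ) × (ι → ℝ) → (κ → ℝ) × (ι → ℝ) := fun p => (p.1, A *ᵥ p.1 + p.2) with hT
  set U : (κ → ℝ) × (ι → ℝ) → (κ → ℝ) × (ι → ℝ) := fun p => (p.1, p.2 - A *ᵥ p.1) with hU
  have hTm : Measurable T := by fun_prop
  have hUm : Measurable U := by fun_prop
  have hUT : Function.LeftInverse U T := fun p => by simp [hT, hU]
  -- the shear `T` preserves the product of the law of `θ` with Lebesgue measure
  have hshear : ((Pr.map θ).prod volume).map T = (Pr.map θ).prod volume := by
    refine (MeasurePreserving.skew_product (g := fun x y => A *ᵥ x + y)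
      (MeasurePreserving.id (Pr.map θ)) (by fun_prop) ?_).map_eq
    exact Filter.Eventually.of_forall fun x => map_add_left_eq_self _ _
  set r : (κ → ℝ) × (ι → ℝ) → ℝ := fun p => f (p.2 - A *ᵥ p.1) / g p.2 with hr
  have hrm : Measurable r := (hfm.comp (by fun_prop)).div (hgm.comp measurable_snd)
  have hr0 (p) : 0 < r p := div_pos (hf0 _) (hg0 _)
  have hJ : (Pr.map fun ω => (θ ω, z ω))
      = ((Pr.map θ).prod (Pr.map z)).withDensity fun p => ENNReal.ofReal (r p) := by
    have h1 : (Pr.map fun ω => (θ ω, z ω)) = ((Pr.map θ).prod (Pr.map n)).map T := by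
      rw [← (indepFun_iff_map_prod_eq_prod_map_map hθ hnG.aemeasurable).1 hind,
        AEMeasurable.map_map_of_aemeasurable hTm.aemeasurable (hθ.prodMk hnG.aemeasurable)]
      congr 1
      funext ω
      simp [hT, hz]
    have hf2 : Measurable fun p : (κ → ℝ) × (ι → ℝ) => ENNReal.ofReal (f p.2) :=
      (hfm.comp measurable_snd).ennreal_ofReal
    have hg2 : Measurable fun p : (κ → ℝ) × (ι → ℝ) => ENNReal.ofReal (g p.2) :=
      (hgm.comp measurable_snd).ennreal_ofReal
    rw [h1, hf, prod_withDensity_right hfm.ennreal_ofReal,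
      map_withDensity_of_leftInverse hTm hUm hUT hf2, hshear,
      hg, prod_withDensity_right hgm.ennreal_ofReal,
      ← withDensity_mul _ hg2 hrm.ennreal_ofReal]
    congr 1
    funext p
    simp only [Function.comp_apply, Pi.mul_apply, hU]
    rw [← ENNReal.ofReal_mul (hg0 _).le, hr]
    congr 1
    have := (hg0 p.2).ne'
    field_simp
  have hac : (Pr.map fun ω => (θ ω, z ω)) ≪ (Pr.map θ).prod (Pr.map z) := by
    rw [hJ]
    exact withDensity_absolutelyContinuous _ _
  have hllr : llr (Pr.map fun ω => (θ ω, z ω)) ((Pr.map θ).prod (Pr.map z))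
      =ᵐ[Pr.map fun ω => (θ ω, z ω)] fun p => Real.log (r p) := by
    refine hac.ae_eq ?_
    have h1 := Measure.rnDeriv_withDensity ((Pr.map θ).prod (Pr.map z)) hrm.ennreal_ofReal
    rw [← hJ] at h1
    filter_upwards [h1] with p hp
    rw [llr, hp, ENNReal.toReal_ofReal (hr0 p).le]
  have hlogm : Measurable fun p => Real.log (r p) := Real.measurable_log.comp hrm
  have hlogr (ω : Ω) : Real.log (r (θ ω, z ω)) = Real.log (f (n ω)) - Real.log (g (z ω)) := by
    rw [hr]
    simp only [hz, add_sub_cancel_left]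
    rw [Real.log_div (hf0 _).ne' (hg0 _).ne']
  rw [mutualInfo, InformationTheory.toReal_klDiv_of_measure_eq hac (by simp),
    integral_congr_ae hllr, integral_map hzθ hlogm.aestronglyMeasurable]
  simp_rw [hlogr]
  rw [integral_sub hfi hgi, hfint, hgint]
  ring

/-- Data processing: a function of `Y` carries no more information than `Y`. -/
theorem mutualInfo_comp_le {α β γ : Type*} [MeasurableSpace α] [MeasurableSpace β]
    [MeasurableSpace γ] [IsFiniteMeasure Pr] {X : Ω → α} {Y : Ω → β} (hX : AEMeasurable X Pr)
    (hY : AEMeasurable Y Pr) {e : β → γ} (he : Measurable e) :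
    mutualInfo Pr X (fun ω => e (Y ω)) ≤ mutualInfo Pr X Y := by
  have hm : Measurable (Prod.map id e : α × β → α × γ) := measurable_id.prodMap he
  have h := InformationTheory.klDiv_map_le (μ := Pr.map fun ω => (X ω, Y ω))
    (ν := (Pr.map X).prod (Pr.map Y)) hm
  rwa [AEMeasurable.map_map_of_aemeasurable hm.aemeasurable (hX.prodMk hY),
    ← Measure.map_prod_map _ _ measurable_id he, Measure.map_id,
    AEMeasurable.map_map_of_aemeasurable he.aemeasurable hY] at h

theorem mutualInfo_measurableEquiv {α β γ : Type*} [MeasurableSpace α] [MeasurableSpace β]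
    [MeasurableSpace γ] [IsFiniteMeasure Pr] {X : Ω → α} {Y : Ω → β} (hX : AEMeasurable X Pr)
    (hY : AEMeasurable Y Pr) (e : β ≃ᵐ γ) :
    mutualInfo Pr X (fun ω => e (Y ω)) = mutualInfo Pr X Y := by
  refine le_antisymm (mutualInfo_comp_le hX hY e.measurable) ?_
  have h := mutualInfo_comp_le hX (e.measurable.comp_aemeasurable hY) e.symm.measurable
  simp only [Function.comp_apply, MeasurableEquiv.symm_apply_apply] at h
  exact h

end ChannelInfo

/-! ### Covariance matrices -/

section CovMatrix

variable {Ω : Type*} [MeasurableSpace Ω] {Pr : Measure Ω}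
  {ι κ l : Type*}

/-- The cross-covariance matrix of two random vectors with arbitrary index types. For `Fin m` and
`Fin n` it is `crossCov` by definition; the more general index types allow stacked vectors. -/
def covMatrix (Pr : Measure Ω) (X : Ω → ι → ℝ) (Y : Ω → κ → ℝ) : Matrix ι κ ℝ :=
  Matrix.of fun i j => cov[fun ω => X ω i, fun ω => Y ω j; Pr]

theorem covMatrix_transpose (X : Ω → ι → ℝ) (Y : Ω → κ → ℝ) :
    (covMatrix Pr X Y)ᵀ = covMatrix Pr Y X := by
  ext i j
  exact covariance_comm _ _

theorem memLp_mulVec [Fintype ι] (A : Matrix l ι ℝ) {X : Ω → ι → ℝ}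
    (hX : ∀ i, MemLp (fun ω => X ω i) 2 Pr) (i : l) : MemLp (fun ω => (A *ᵥ X ω) i) 2 Pr :=
  memLp_finsetSum _ fun k _ => (hX k).const_mul _

theorem covMatrix_eq_zero_of_indepFun {X : Ω → ι → ℝ} {Y : Ω → κ → ℝ}
    (hX : ∀ i, MemLp (fun ω => X ω i) 2 Pr) (hY : ∀ i, MemLp (fun ω => Y ω i) 2 Pr)
    (h : IndepFun X Y Pr) : covMatrix Pr X Y = 0 := by
  ext i j
  exact (h.comp (measurable_pi_apply i) (measurable_pi_apply j)).covariance_eq_zero (hX i) (hY j)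

variable [IsProbabilityMeasure Pr]

theorem covMatrix_add_left {X X' : Ω → ι → ℝ} {Y : Ω → κ → ℝ}
    (hX : ∀ i, MemLp (fun ω => X ω i) 2 Pr) (hX' : ∀ i, MemLp (fun ω => X' ω i) 2 Pr)
    (hY : ∀ i, MemLp (fun ω => Y ω i) 2 Pr) :
    covMatrix Pr (fun ω => X ω + X' ω) Y = covMatrix Pr X Y + covMatrix Pr X' Y := by
  ext i j
  exact covariance_add_left (hX i) (hX' i) (hY j)

theorem covMatrix_add_right {X X' : Ω → ι → ℝ} {Y : Ω → κ → ℝ}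
    (hX : ∀ i, MemLp (fun ω => X ω i) 2 Pr) (hX' : ∀ i, MemLp (fun ω => X' ω i) 2 Pr)
    (hY : ∀ i, MemLp (fun ω => Y ω i) 2 Pr) :
    covMatrix Pr Y (fun ω => X ω + X' ω) = covMatrix Pr Y X + covMatrix Pr Y X' := by
  ext i j
  exact covariance_add_right (hY i) (hX j) (hX' j)

theorem covMatrix_mulVec_left [Fintype ι] (A : Matrix l ι ℝ) {X : Ω → ι → ℝ} {Y : Ω → κ → ℝ}
    (hX : ∀ i, MemLp (fun ω => X ω i) 2 Pr) (hY : ∀ i, MemLp (fun ω => Y ω i) 2 Pr) :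
    covMatrix Pr (fun ω => A *ᵥ X ω) Y = A * covMatrix Pr X Y := by
  ext i j
  simp only [covMatrix, of_apply, mulVec, dotProduct, mul_apply]
  rw [covariance_fun_sum_left (fun k => (hX k).const_mul _) (hY j)]
  simp_rw [covariance_const_mul_left]

theorem covMatrix_mulVec_right [Fintype ι] (A : Matrix l ι ℝ) {X : Ω → ι → ℝ} {Y : Ω → κ → ℝ}
    (hX : ∀ i, MemLp (fun ω => X ω i) 2 Pr) (hY : ∀ i, MemLp (fun ω => Y ω i) 2 Pr) :
    covMatrix Pr Y (fun ω => A *ᵥ X ω) = covMatrix Pr Y X * Aᵀ := by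
  rw [← covMatrix_transpose, covMatrix_mulVec_left A hX hY, transpose_mul, covMatrix_transpose]

end CovMatrix

/-! ### The information gain as a difference of log-determinants -/

section Determinants

variable {p s t : ℕ}

/-- The determinant of the covariance of the stacked outputs of the channels `F` and `K` with common
input covariance `Q`, by the Schur complement of the first block. The Woodbury identity recognizes
in it the conditional covariance of the input given the first output. -/
theorem det_two_channels {Q : Matrix (Fin p) (Fin p) ℝ} (hQ : Q.PosDef)
    {U : Matrix (Fin s) (Fin s) ℝ} (hU : U.PosDef) (V : Matrix (Fin t) (Fin t) ℝ)
    (F : Matrix (Fin s) (Fin p) ℝ) (K : Matrix (Fin t) (Fin p) ℝ) :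
    (fromBlocks (F * Q * Fᵀ + U) (F * Q * Kᵀ) (K * Q * Fᵀ) (K * Q * Kᵀ + V)).det
      = (F * Q * Fᵀ + U).det * (V + K * (Q⁻¹ + Fᵀ * U⁻¹ * F)⁻¹ * Kᵀ).det := by
  have hX : (F * Q * Fᵀ + U).PosDef := by
    refine PosDef.posSemidef_add ?_ hU
    simpa using hQ.posSemidef.mul_mul_conjTranspose_same F
  have hQu := hQ.det_pos.ne'.isUnit
  have hUu := hU.det_pos.ne'.isUnit
  have := invertibleOfIsUnitDet _ hX.det_pos.ne'.isUnit
  rw [det_fromBlocks₁₁, invOf_eq_nonsing_inv]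
  congr 2
  have hW := add_mul_mul_inv_eq_sub Q⁻¹ Fᵀ U⁻¹ F hQ.inv.isUnit hU.inv.isUnit (by
    rw [nonsing_inv_nonsing_inv _ hUu, nonsing_inv_nonsing_inv _ hQu, add_comm]
    exact hX.isUnit)
  rw [hW, nonsing_inv_nonsing_inv _ hUu, nonsing_inv_nonsing_inv _ hQu, add_comm U]
  simp only [Matrix.mul_sub, Matrix.sub_mul, Matrix.mul_assoc]
  abel

end Determinants

section InfoGain

variable {Ω : Type*} [MeasurableSpace Ω] {Pr : Measure Ω} {p q s t : ℕ}
  {θ : Ω → Fin p → ℝ} {φ : Ω → Fin q → ℝ} {u : Ω → Fin s → ℝ} {v : Ω → Fin t → ℝ}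

/-- The information gain for general covariances. With `φ = M θ + r`, the second output is
`y = G M θ + e` with the noise `e = G r + v`, which is independent of `(θ, u)` and has covariance
`G Q_{φφ|θ} Gᵀ + Q_vv`. Thus both informations in the gain are those of a linear Gaussian channel
with input `θ`. -/
theorem IsGaussianModel.infoGain_eq [IsProbabilityMeasure Pr] (h : IsGaussianModel Pr θ φ u v)
    (hQθ : (crossCov Pr θ θ).PosDef) (hQu : (crossCov Pr u u).PosDef)
    (F : Matrix (Fin s) (Fin p) ℝ) (G : Matrix (Fin t) (Fin q) ℝ)
    (hV : (G * condCov Pr φ θ * Gᵀ + crossCov Pr v v).PosDef) :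
    infoGain Pr θ φ u v F G =
      (Real.log (G * condCov Pr φ θ * Gᵀ + crossCov Pr v v
          + G * (estMatrix Pr θ φ * postCov Pr θ u F * (estMatrix Pr θ φ)ᵀ) * Gᵀ).det
        - Real.log (G * condCov Pr φ θ * Gᵀ + crossCov Pr v v).det) / 2 := by
  have hcc {m n : ℕ} (X : Ω → Fin m → ℝ) (Y : Ω → Fin n → ℝ) :
      crossCov Pr X Y = covMatrix Pr X Y := rfl
  have hθG : HasGaussianLaw θ Pr := h.signals.fst
  have hφG : HasGaussianLaw φ Pr := h.signals.snd
  have hθ (i) : MemLp (fun ω => θ ω i) 2 Pr := (hθG.eval i).memLp_two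
  have hφ (i) : MemLp (fun ω => φ ω i) 2 Pr := (hφG.eval i).memLp_two
  have hu (i) : MemLp (fun ω => u ω i) 2 Pr := (h.noise_u.eval i).memLp_two
  have hv (i) : MemLp (fun ω => v ω i) 2 Pr := (h.noise_v.eval i).memLp_two
  have hindep := h.indep_signals
  have huθ : covMatrix Pr u θ = 0 :=
    covMatrix_eq_zero_of_indepFun hu hθ (hindep.comp measurable_fst measurable_fst)
  have hvθ : covMatrix Pr v θ = 0 :=
    covMatrix_eq_zero_of_indepFun hv hθ (hindep.comp measurable_snd measurable_fst)
  have huφ : covMatrix Pr u φ = 0 :=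
    covMatrix_eq_zero_of_indepFun hu hφ (hindep.comp measurable_fst measurable_snd)
  have hvφ : covMatrix Pr v φ = 0 :=
    covMatrix_eq_zero_of_indepFun hv hφ (hindep.comp measurable_snd measurable_snd)
  have huv : covMatrix Pr u v = 0 := covMatrix_eq_zero_of_indepFun hu hv h.indep_noises
  set Q := crossCov Pr θ θ with hQ
  set M := estMatrix Pr θ φ with hM
  have hQunit := hQθ.det_pos.ne'.isUnit
  have hMQ : M * Q = crossCov Pr φ θ := by
    rw [hM, estMatrix, Matrix.mul_assoc, nonsing_inv_mul _ hQunit, Matrix.mul_one]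
  -- the part `φ - M θ` of `φ` that is uncorrelated with `θ`
  set r : Ω → Fin q → ℝ := fun ω => φ ω + (-M) *ᵥ θ ω with hr
  have hMθ (i) : MemLp (fun ω => ((-M) *ᵥ θ ω) i) 2 Pr := memLp_mulVec _ hθ i
  have hrL (i) : MemLp (fun ω => r ω i) 2 Pr := (hφ i).add (hMθ i)
  have hrθ : covMatrix Pr r θ = 0 := by
    rw [hr, covMatrix_add_left hφ hMθ hθ, covMatrix_mulVec_left _ hθ hθ, ← hcc, ← hcc, ← hQ,
      Matrix.neg_mul, hMQ, add_neg_cancel]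
  have hrr : covMatrix Pr r r = condCov Pr φ θ := by
    conv_lhs => rw [hr]
    rw [covMatrix_add_right hφ hMθ (by exact hrL), covMatrix_mulVec_right _ hθ (by exact hrL)]
    change covMatrix Pr r φ + covMatrix Pr r θ * _ = _
    rw [hrθ, Matrix.zero_mul, add_zero, hr, covMatrix_add_left hφ hMθ hφ,
      covMatrix_mulVec_left _ hθ hφ, condCov, Matrix.neg_mul, ← sub_eq_add_neg]
    rfl
  have hur : covMatrix Pr u r = 0 := by
    rw [hr, covMatrix_add_right hφ hMθ hu, covMatrix_mulVec_right _ hθ hu, huφ, huθ]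
    simp
  have hvr : covMatrix Pr v r = 0 := by
    rw [hr, covMatrix_add_right hφ hMθ hv, covMatrix_mulVec_right _ hθ hv, hvφ, hvθ]
    simp
  -- the noise of the second channel, seen as a channel with input `θ`
  set e : Ω → Fin t → ℝ := fun ω => G *ᵥ r ω + v ω with he
  have hGr (i) : MemLp (fun ω => (G *ᵥ r ω) i) 2 Pr := memLp_mulVec _ hrL i
  have heL (i) : MemLp (fun ω => e ω i) 2 Pr := (hGr i).add (hv i)
  have heθ : covMatrix Pr e θ = 0 := by
    rw [he, covMatrix_add_left hGr hv hθ, covMatrix_mulVec_left _ hrL hθ, hrθ, hvθ]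
    simp
  have hue : covMatrix Pr u e = 0 := by
    rw [he, covMatrix_add_right hGr hv hu, covMatrix_mulVec_right _ hrL hu, hur, huv]
    simp
  have hve : covMatrix Pr v e = crossCov Pr v v := by
    rw [he, covMatrix_add_right hGr hv hv, covMatrix_mulVec_right _ hrL hv, hvr]
    simp [hcc]
  have hre : covMatrix Pr r e = condCov Pr φ θ * Gᵀ := by
    have hrv : covMatrix Pr r v = 0 := by rw [← covMatrix_transpose, hvr, transpose_zero]
    rw [he, covMatrix_add_right hGr hv hrL, covMatrix_mulVec_right _ hrL hrL, hrv, hrr, add_zero]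
  set V := G * condCov Pr φ θ * Gᵀ + crossCov Pr v v with hVdef
  have hee : covMatrix Pr e e = V := by
    conv_lhs => rw [he]
    rw [covMatrix_add_left hGr hv (by exact heL), covMatrix_mulVec_left _ hrL (by exact heL)]
    change G * covMatrix Pr r e + covMatrix Pr v e = _
    rw [hre, hve, hVdef, Matrix.mul_assoc]
  set A : Matrix (Fin s ⊕ Fin t) (Fin p) ℝ := fromRows F (G * M) with hA
  set n : Ω → Fin s ⊕ Fin t → ℝ := fun ω => Sum.elim (u ω) (e ω)
  set z : Ω → Fin s ⊕ Fin t → ℝ := fun ω => A *ᵥ θ ω + n ω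
  have hnL (i) : MemLp (fun ω => n ω i) 2 Pr := by
    rcases i with i | i
    · exact hu i
    · exact heL i
  have hnθ : covMatrix Pr n θ = 0 := by
    ext (i | i) j
    · exact congrFun (congrFun huθ i) j
    · exact congrFun (congrFun heθ i) j
  have hnn : covMatrix Pr n n = fromBlocks (crossCov Pr u u) 0 0 V := by
    ext (i | i) (j | j)
    · rfl
    · exact congrFun (congrFun hue i) j
    · rw [← covMatrix_transpose]
      exact congrFun (congrFun hue j) i
    · exact congrFun (congrFun hee i) j
  -- all vectors in sight are linear images of the jointly Gaussian `((u, v), (θ, φ))`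
  have hall : HasGaussianLaw (fun ω => ((u ω, v ω), (θ ω, φ ω))) Pr :=
    hindep.hasGaussianLaw (h.indep_noises.hasGaussianLaw h.noise_u h.noise_v) h.signals
  have hjoint : HasGaussianLaw (fun ω => (θ ω, n ω)) Pr := by
    let Λ : ((Fin s → ℝ) × (Fin t → ℝ)) × ((Fin p → ℝ) × (Fin q → ℝ)) →ₗ[ℝ]
        (Fin p → ℝ) × (Fin s ⊕ Fin t → ℝ) :=
      { toFun := fun w => (w.2.1,
          Sum.elim w.1.1 (G *ᵥ (w.2.2 + (-M) *ᵥ w.2.1) + w.1.2))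
        map_add' := fun w w' => by
          refine Prod.ext rfl ?_
          funext i
          rcases i with i | i
          · rfl
          · simp only [Prod.fst_add, Prod.snd_add, mulVec_add, Sum.elim_inr, Pi.add_apply]
            ring
        map_smul' := fun c w => by
          refine Prod.ext rfl ?_
          funext i
          rcases i with i | i
          · rfl
          · simp only [Prod.smul_fst, Prod.smul_snd, mulVec_add, mulVec_smul, Sum.elim_inr,
              Pi.add_apply, Pi.smul_apply, smul_eq_mul, RingHom.id_apply]
            ring }
    exact hall.map (LinearMap.toContinuousLinearMap Λ)
  have hzG : HasGaussianLaw z Pr := by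
    have h1 := hjoint.map (((LinearMap.toContinuousLinearMap (toLin' A)).comp
      (ContinuousLinearMap.fst ℝ _ _)) + ContinuousLinearMap.snd ℝ _ _)
    exact h1
  have hind : IndepFun θ n Pr := by
    refine HasGaussianLaw.indepFun_of_covariance_eval (X := fun i ω => θ ω i)
      (Y := fun i ω => n ω i) hjoint fun i j => ?_
    rw [covariance_comm]
    exact congrFun (congrFun hnθ j) i
  have hVb : (fromBlocks (crossCov Pr u u) 0 0 V).PosDef := by
    have := invertibleOfIsUnitDet _ hQu.det_pos.ne'.isUnit
    have h1 := (PosDef.fromBlocks₁₁ (A := crossCov Pr u u) (B := (0 : Matrix (Fin s) (Fin t) ℝ)) V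
      hQu).2 (by simpa using hV.posSemidef)
    rw [conjTranspose_zero] at h1
    refine (h1.posDef_iff_det_ne_zero).2 ?_
    rw [det_fromBlocks_zero₂₁]
    exact mul_ne_zero hQu.det_pos.ne' hV.det_pos.ne'
  have hAQA : (A * Q * Aᵀ).PosSemidef := by
    simpa using hQθ.posSemidef.mul_mul_conjTranspose_same A
  have cov_channel {k : Type} [Fintype k] (B : Matrix k (Fin p) ℝ) {w : Ω → k → ℝ}
      (hw : ∀ i, MemLp (fun ω => w ω i) 2 Pr) (hwθ : covMatrix Pr w θ = 0) :
      covMatrix Pr (fun ω => B *ᵥ θ ω + w ω) (fun ω => B *ᵥ θ ω + w ω)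
        = B * Q * Bᵀ + covMatrix Pr w w := by
    have hB (i) : MemLp (fun ω => (B *ᵥ θ ω) i) 2 Pr := memLp_mulVec _ hθ i
    have hθw : covMatrix Pr θ w = 0 := by rw [← covMatrix_transpose, hwθ, transpose_zero]
    have hBw (i) : MemLp (fun ω => (B *ᵥ θ ω + w ω) i) 2 Pr := (hB i).add (hw i)
    rw [covMatrix_add_left hB hw hBw, covMatrix_add_right hB hw hB,
      covMatrix_add_right hB hw hw, covMatrix_mulVec_left _ hθ hB, covMatrix_mulVec_left _ hθ hw,
      covMatrix_mulVec_right _ hθ hθ, covMatrix_mulVec_right _ hθ hw, hθw, hwθ]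
    simp [Matrix.mul_assoc, hQ, hcc]
  -- both outputs together are the output `z` of the stacked channel `A` with noise `n`
  have hI₁ : (mutualInfo Pr θ fun ω => (channel F θ u ω, channel G φ v ω)).toReal
      = (Real.log (A * Q * Aᵀ + fromBlocks (crossCov Pr u u) 0 0 V).det
        - Real.log (fromBlocks (crossCov Pr u u) 0 0 V).det) / 2 := by
    have h1 : (fun ω => (channel F θ u ω, channel G φ v ω))
        = fun ω => MeasurableEquiv.sumPiEquivProdPi (fun _ : Fin s ⊕ Fin t => ℝ) (z ω) := by
      funext ω
      refine Prod.ext ?_ ?_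
      · funext i
        rfl
      · have h2 : channel G φ v ω = (G * M) *ᵥ θ ω + e ω := by
          simp only [channel, he, hr, mulVec_add, mulVec_mulVec, neg_mulVec, mulVec_neg]
          abel
        rw [h2]
        funext i
        rfl
    rw [h1, mutualInfo_measurableEquiv hθG.aemeasurable hzG.aemeasurable]
    refine toReal_mutualInfo_channel (fun ω => rfl) hθG.aemeasurable hjoint.snd hzG hind hVb
      (PosDef.posSemidef_add hAQA hVb) (fun i j => congrFun (congrFun hnn i) j) fun i j => ?_
    have h3 := cov_channel A hnL hnθ
    rw [hnn] at h3
    exact congrFun (congrFun h3 i) j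
  have hI₂ : (mutualInfo Pr θ (channel F θ u)).toReal
      = (Real.log (F * Q * Fᵀ + crossCov Pr u u).det - Real.log (crossCov Pr u u).det) / 2 := by
    refine toReal_mutualInfo_channel (fun ω => rfl) hθG.aemeasurable h.noise_u ?_
      (hindep.comp measurable_fst measurable_fst).symm hQu
      (PosDef.posSemidef_add ?_ hQu) (fun i j => rfl) fun i j => ?_
    · have h1 := hall.map (((LinearMap.toContinuousLinearMap (toLin' F)).comp
        ((ContinuousLinearMap.fst ℝ _ _).comp (ContinuousLinearMap.snd ℝ _ _))) +
          (ContinuousLinearMap.fst ℝ _ _).comp (ContinuousLinearMap.fst ℝ _ _))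
      exact h1
    · simpa using hQθ.posSemidef.mul_mul_conjTranspose_same F
    · exact congrFun (congrFun (cov_channel F hu huθ) i) j
  have hblocks : A * Q * Aᵀ + fromBlocks (crossCov Pr u u) 0 0 V
      = fromBlocks (F * Q * Fᵀ + crossCov Pr u u) (F * Q * (G * M)ᵀ) ((G * M) * Q * Fᵀ)
        ((G * M) * Q * (G * M)ᵀ + V) := by
    rw [hA, fromRows_mul, transpose_fromRows, fromRows_mul_fromCols, fromBlocks_add]
    simp
  have hX : (F * Q * Fᵀ + crossCov Pr u u).PosDef :=
    PosDef.posSemidef_add (by simpa using hQθ.posSemidef.mul_mul_conjTranspose_same F) hQu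
  have hpost : (postCov Pr θ u F).PosSemidef := by
    refine (PosDef.add_posSemidef hQθ.inv ?_).inv.posSemidef
    simpa using hQu.inv.posSemidef.conjTranspose_mul_mul_same F
  have hY : (V + (G * M) * postCov Pr θ u F * (G * M)ᵀ).PosDef :=
    hV.add_posSemidef (by simpa using hpost.mul_mul_conjTranspose_same (G * M))
  rw [infoGain, hI₁, hI₂, hblocks, det_two_channels hQθ hQu, det_fromBlocks_zero₂₁,
    Real.log_mul hX.det_pos.ne' (by exact hY.det_pos.ne'),
    Real.log_mul hQu.det_pos.ne' hV.det_pos.ne']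
  have hfin : (G * M) * (Q⁻¹ + Fᵀ * (crossCov Pr u u)⁻¹ * F)⁻¹ * (G * M)ᵀ
      = G * (M * postCov Pr θ u F * Mᵀ) * Gᵀ := by
    rw [postCov, transpose_mul]
    simp only [Matrix.mul_assoc]
    rfl
  rw [hfin]
  ring

end InfoGain

/-! ### Reduction to the eigenbases -/

section Diagonalization

variable {t q : ℕ} {Uv : Matrix (Fin t) (Fin t) ℝ} {Uξ : Matrix (Fin q) (Fin q) ℝ}

theorem det_orthogonal_conj (hUv : Uv ∈ orthogonalGroup (Fin t) ℝ) (X : Matrix (Fin t) (Fin t) ℝ) :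
    (Uv * X * Uvᵀ).det = X.det := by
  have h1 : Uv * Uvᵀ = 1 := mem_orthogonalGroup_iff _ _ |>.1 hUv
  have h2 := congrArg det h1
  rw [det_mul, det_one] at h2
  rw [det_mul, det_mul]
  linear_combination X.det * h2

/-- The covariance `outCov` in the eigenbases `Uv` and `Uξ`, transported back. -/
theorem conj_outCov (hUv : Uv ∈ orthogonalGroup (Fin t) ℝ) (b : Fin t → ℝ) (e : Fin q → ℝ)
    (G : Matrix (Fin t) (Fin q) ℝ) :
    Uv * outCov b e (Uvᵀ * G * Uξ) * Uvᵀ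
      = Uv * diagonal b * Uvᵀ + G * (Uξ * diagonal e * Uξᵀ) * Gᵀ := by
  have h1 : Uv * Uvᵀ = 1 := mem_orthogonalGroup_iff _ _ |>.1 hUv
  rw [outCov, Matrix.mul_add, Matrix.add_mul]
  congr 1
  simp only [transpose_mul, transpose_transpose]
  calc _ = (Uv * Uvᵀ) * (G * (Uξ * diagonal e * Uξᵀ) * Gᵀ) * (Uv * Uvᵀ) := by
        simp only [Matrix.mul_assoc]
    _ = _ := by rw [h1, Matrix.one_mul, Matrix.mul_one]

theorem trace_orthogonal (hUv : Uv ∈ orthogonalGroup (Fin t) ℝ)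
    (hUξ : Uξ ∈ orthogonalGroup (Fin q) ℝ) (G : Matrix (Fin t) (Fin q) ℝ) :
    ((Uvᵀ * G * Uξ) * (Uvᵀ * G * Uξ)ᵀ).trace = (G * Gᵀ).trace := by
  have h1 : Uv * Uvᵀ = 1 := mem_orthogonalGroup_iff _ _ |>.1 hUv
  have h2 : Uξ * Uξᵀ = 1 := mem_orthogonalGroup_iff _ _ |>.1 hUξ
  calc _ = (Uvᵀ * (G * (Uξ * Uξᵀ) * Gᵀ * Uv)).trace := by
        simp only [transpose_mul, transpose_transpose, Matrix.mul_assoc]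
    _ = (G * (Uξ * Uξᵀ) * Gᵀ * (Uv * Uvᵀ)).trace := by
        rw [trace_mul_comm]
        simp only [Matrix.mul_assoc]
    _ = _ := by rw [h1, h2, Matrix.mul_one, Matrix.mul_one]

theorem orthogonal_conj_eq_iff (hUv : Uv ∈ orthogonalGroup (Fin t) ℝ)
    (hUξ : Uξ ∈ orthogonalGroup (Fin q) ℝ) (G D : Matrix (Fin t) (Fin q) ℝ) :
    Uvᵀ * G * Uξ = D ↔ G = Uv * D * Uξᵀ := by
  have h1 : Uv * Uvᵀ = 1 := mem_orthogonalGroup_iff _ _ |>.1 hUv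
  have h2 : Uξ * Uξᵀ = 1 := mem_orthogonalGroup_iff _ _ |>.1 hUξ
  have h3 : Uvᵀ * Uv = 1 := mem_orthogonalGroup_iff' _ _ |>.1 hUv
  have h4 : Uξᵀ * Uξ = 1 := mem_orthogonalGroup_iff' _ _ |>.1 hUξ
  constructor
  · rintro rfl
    calc G = (Uv * Uvᵀ) * G * (Uξ * Uξᵀ) := by rw [h1, h2, Matrix.one_mul, Matrix.mul_one]
      _ = _ := by simp only [Matrix.mul_assoc]
  · rintro rfl
    calc _ = (Uvᵀ * Uv) * D * (Uξᵀ * Uξ) := by simp only [Matrix.mul_assoc]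
      _ = D := by rw [h3, h4, Matrix.one_mul, Matrix.mul_one]

end Diagonalization

section Reduction

variable {Ω : Type*} [MeasurableSpace Ω] {Pr : Measure Ω} {p q s t : ℕ}
  {θ : Ω → Fin p → ℝ} {φ : Ω → Fin q → ℝ} {u : Ω → Fin s → ℝ} {v : Ω → Fin t → ℝ}
  {F : Matrix (Fin s) (Fin p) ℝ} {c : ℝ} {Uv : Matrix (Fin t) (Fin t) ℝ} {b : Fin t → ℝ}
  {Uξ : Matrix (Fin q) (Fin q) ℝ} {a : Fin q → ℝ}

theorem eigenvalues_nonneg (hQθ : (crossCov Pr θ θ).PosDef) (hQu : (crossCov Pr u u).PosDef)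
    (hUξ : Uξ ∈ orthogonalGroup (Fin q) ℝ)
    (hξ : estMatrix Pr θ φ * postCov Pr θ u F * (estMatrix Pr θ φ)ᵀ = Uξ * diagonal a * Uξᵀ)
    (j : Fin q) : 0 ≤ a j := by
  have hpost : (postCov Pr θ u F).PosSemidef := by
    refine (PosDef.add_posSemidef hQθ.inv ?_).inv.posSemidef
    simpa using hQu.inv.posSemidef.conjTranspose_mul_mul_same F
  have h1 : (Uξ * diagonal a * Uξᵀ).PosSemidef := by
    rw [← hξ]
    simpa using hpost.mul_mul_conjTranspose_same (estMatrix Pr θ φ)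
  have h2 := h1.conjTranspose_mul_mul_same Uξ
  have h3 : Uξᵀ * Uξ = 1 := mem_orthogonalGroup_iff' _ _ |>.1 hUξ
  have h4 : Uξᴴ * (Uξ * diagonal a * Uξᵀ) * Uξ = diagonal a := by
    rw [conjTranspose_eq_transpose_of_trivial]
    calc _ = (Uξᵀ * Uξ) * diagonal a * (Uξᵀ * Uξ) := by simp only [Matrix.mul_assoc]
      _ = _ := by rw [h3, Matrix.one_mul, Matrix.mul_one]
  rw [h4] at h2
  exact posSemidef_diagonal_iff.1 h2 j

theorem IsGaussianModel.infoGain_eq_logDetGain [IsProbabilityMeasure Pr]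
    (h : IsGaussianModel Pr θ φ u v)
    (hQθ : (crossCov Pr θ θ).PosDef) (hQu : (crossCov Pr u u).PosDef) (hc : 0 < c)
    (hQφ : condCov Pr φ θ = c • (1 : Matrix (Fin q) (Fin q) ℝ))
    (hUv : Uv ∈ orthogonalGroup (Fin t) ℝ) (hb : ∀ i, 0 < b i)
    (hQv : crossCov Pr v v = Uv * diagonal b * Uvᵀ) (hUξ : Uξ ∈ orthogonalGroup (Fin q) ℝ)
    (hξ : estMatrix Pr θ φ * postCov Pr θ u F * (estMatrix Pr θ φ)ᵀ = Uξ * diagonal a * Uξᵀ)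
    (G : Matrix (Fin t) (Fin q) ℝ) :
    infoGain Pr θ φ u v F G = logDetGain b a c (Uvᵀ * G * Uξ) / 2 := by
  have h2 : Uξ * Uξᵀ = 1 := mem_orthogonalGroup_iff _ _ |>.1 hUξ
  have hone : Uξ * diagonal (fun _ => c) * Uξᵀ = condCov Pr φ θ := by
    have hd : (diagonal (fun _ => c) : Matrix (Fin q) (Fin q) ℝ) = c • 1 := by
      rw [smul_one_eq_diagonal]
    rw [hd, hQφ, Matrix.mul_smul, Matrix.mul_one, Matrix.smul_mul, h2]
  have hadd : Uξ * diagonal (fun j => c + a j) * Uξᵀ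
      = condCov Pr φ θ + estMatrix Pr θ φ * postCov Pr θ u F * (estMatrix Pr θ φ)ᵀ := by
    rw [hξ, ← hone, ← Matrix.add_mul, ← Matrix.mul_add, diagonal_add]
  have e1 : G * condCov Pr φ θ * Gᵀ + crossCov Pr v v
      = Uv * outCov b (fun _ => c) (Uvᵀ * G * Uξ) * Uvᵀ := by
    rw [conj_outCov hUv, hone, hQv, add_comm]
  have e2 : G * condCov Pr φ θ * Gᵀ + crossCov Pr v v
      + G * (estMatrix Pr θ φ * postCov Pr θ u F * (estMatrix Pr θ φ)ᵀ) * Gᵀ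
      = Uv * outCov b (fun j => c + a j) (Uvᵀ * G * Uξ) * Uvᵀ := by
    rw [conj_outCov hUv, hadd, hQv, Matrix.mul_add, Matrix.add_mul]
    abel
  have hV : (G * condCov Pr φ θ * Gᵀ + crossCov Pr v v).PosDef := by
    have h1 := outCov_posDef (e := fun _ => c) hb (fun _ => hc.le) (Uvᵀ * G * Uξ)
    have hps : (Uv * outCov b (fun _ => c) (Uvᵀ * G * Uξ) * Uvᵀ).PosSemidef := by
      simpa using h1.posSemidef.mul_mul_conjTranspose_same Uv
    rw [e1, hps.posDef_iff_det_ne_zero, det_orthogonal_conj hUv]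
    exact h1.det_pos.ne'
  rw [h.infoGain_eq hQθ hQu F G hV, e2, e1, det_orthogonal_conj hUv, det_orthogonal_conj hUv]
  rfl

theorem IsGaussianModel.isOptimal_iff_isMaximizer [IsProbabilityMeasure Pr]
    (h : IsGaussianModel Pr θ φ u v)
    (hQθ : (crossCov Pr θ θ).PosDef) (hQu : (crossCov Pr u u).PosDef) (hc : 0 < c)
    (hQφ : condCov Pr φ θ = c • (1 : Matrix (Fin q) (Fin q) ℝ))
    (hUv : Uv ∈ orthogonalGroup (Fin t) ℝ) (hb : ∀ i, 0 < b i)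
    (hQv : crossCov Pr v v = Uv * diagonal b * Uvᵀ) (hUξ : Uξ ∈ orthogonalGroup (Fin q) ℝ)
    (hξ : estMatrix Pr θ φ * postCov Pr θ u F * (estMatrix Pr θ φ)ᵀ = Uξ * diagonal a * Uξᵀ)
    (P : ℝ) (G : Matrix (Fin t) (Fin q) ℝ) :
    IsOptimal Pr θ φ u v F P G ↔ IsMaximizer b a c P (Uvᵀ * G * Uξ) := by
  have hgain := h.infoGain_eq_logDetGain (F := F) hQθ hQu hc hQφ hUv hb hQv hUξ hξ
  rw [IsOptimal, IsMaximizer, trace_orthogonal hUv hUξ]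
  refine and_congr_right fun _ => ⟨fun hopt D hD => ?_, fun hmax H hH => ?_⟩
  · have hG := (orthogonal_conj_eq_iff hUv hUξ (Uv * D * Uξᵀ) D).2 rfl
    have h1 := hopt (Uv * D * Uξᵀ) (by rwa [← trace_orthogonal hUv hUξ, hG])
    rw [hgain, hgain, hG] at h1
    linarith
  · have h1 := hmax (Uvᵀ * H * Uξ) (by rwa [trace_orthogonal hUv hUξ])
    rw [hgain, hgain]
    linarith

end Reduction

end TwoChannel

end

theorem theorem1 {Ω : Type*} [MeasurableSpace Ω] (Pr : Measure Ω) [IsProbabilityMeasure Pr]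
    {p q s t : ℕ} (ht : 0 < t) (htq : t ≤ q)
    (θ : Ω → Fin p → ℝ) (φ : Ω → Fin q → ℝ) (u : Ω → Fin s → ℝ) (v : Ω → Fin t → ℝ)
    (hmodel : TwoChannel.IsGaussianModel Pr θ φ u v)
    (F : Matrix (Fin s) (Fin p) ℝ)
    (hQθ : (TwoChannel.crossCov Pr θ θ).PosDef)
    (hQu : (TwoChannel.crossCov Pr u u).PosDef)
    (c : ℝ) (hc : 0 < c)
    (hQφ : TwoChannel.condCov Pr φ θ = c • (1 : Matrix (Fin q) (Fin q) ℝ))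
    (P : ℝ) (hP : 0 < P)
    -- eigendecomposition of the covariance of `v`, with distinct positive eigenvalues
    (Uv : Matrix (Fin t) (Fin t) ℝ) (hUv : Uv ∈ Matrix.orthogonalGroup (Fin t) ℝ)
    (b : Fin t → ℝ) (hb_pos : ∀ i, 0 < b i) (hb : StrictMono b)
    (hQv : TwoChannel.crossCov Pr v v = Uv * Matrix.diagonal b * Uvᵀ)
    -- eigendecomposition of `M Q_{θθ|x} Mᵀ`, with distinct nonzero eigenvalues
    (Uξ : Matrix (Fin q) (Fin q) ℝ) (hUξ : Uξ ∈ Matrix.orthogonalGroup (Fin q) ℝ)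
    (a : Fin q → ℝ) (ha : Antitone a) (ha_distinct : ∀ i j, i < j → a i ≠ 0 → a j ≠ a i)
    (hξ : TwoChannel.estMatrix Pr θ φ * TwoChannel.postCov Pr θ u F *
      (TwoChannel.estMatrix Pr θ φ)ᵀ = Uξ * Matrix.diagonal a * Uξᵀ)
    (ha_ne : ∃ i, a i ≠ 0) :
    (∃! μ : ℝ, 0 < μ ∧ ∃ κ : ℕ,
      TwoChannel.IsActiveCount
        (fun i : Fin t => TwoChannel.waterLevel c (b i) (a (Fin.castLE htq i)) μ)
        (Matrix.diagonal a).rank κ ∧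
      ∑ i : Fin t, (if (i : ℕ) < κ then
        TwoChannel.waterLevel c (b i) (a (Fin.castLE htq i)) μ else 0) = P) ∧
    ∀ (μ : ℝ) (κ : ℕ), 0 < μ →
      TwoChannel.IsActiveCount
        (fun i : Fin t => TwoChannel.waterLevel c (b i) (a (Fin.castLE htq i)) μ)
        (Matrix.diagonal a).rank κ →
      ∑ i : Fin t, (if (i : ℕ) < κ then
        TwoChannel.waterLevel c (b i) (a (Fin.castLE htq i)) μ else 0) = P →
      ∀ G : Matrix (Fin t) (Fin q) ℝ,
        TwoChannel.IsOptimal Pr θ φ u v F P G ↔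
          ∃ d : Fin t → ℝ,
            (∀ i, d i ^ 2 = if (i : ℕ) < κ then
              TwoChannel.waterLevel c (b i) (a (Fin.castLE htq i)) μ else 0) ∧
            G = Uv * TwoChannel.rectDiag q d * Uξᵀ := by
  have ha0 := TwoChannel.eigenvalues_nonneg hQθ hQu hUξ hξ
  refine ⟨TwoChannel.existsUnique_multiplier ht htq hb_pos hb ha0 ha ha_ne hc hP, ?_⟩
  intro μ κ hμ hκ hsum G
  rw [hmodel.isOptimal_iff_isMaximizer hQθ hQu hc hQφ hUv hb_pos hQv hUξ hξ,
    TwoChannel.isMaximizer_iff_waterLevel ht htq hb_pos hb ha0 ha ha_distinct ha_ne hc hP hμ hκ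
      hsum]
  simp_rw [TwoChannel.orthogonal_conj_eq_iff hUv hUξ]
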